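/- Consider the nonlinear program $\min_{x\in\mathbb{R}^n} f(x)$ subject to $g(x)=0$, $h(x)\le 0$, with $f:\mathbb{R}^n\to\mathbb{R}$, $g:\mathbb{R}^n\to\mathbb{R}^{m_e}$, $h:\mathbb{R}^n\to\mathbb{R}^{m_i}$ of class $C^2$ and $m_i\ge 1$ (bounds on $x$ are included in $h$). With a slack $s\ge 0$, $h(x)+s=0$, and multipliers $y,z,v$, let $p=(x,s,y,z)$ and $$L(p,v)=f(x)+y^\top g(x)+z^\top(h(x)+s)-v^\top s .$$ Let $(p^\star,v^\star)$ be a KKT point, that is, $\nabla_p L(p^\star,v^\star)=0$, $s^\star,v^\star\ge 0$ and $s^\star_iv^\star_i=0$ for all $i$. Let $\mathcal B=\{i : h_i(x^\star)=0\}$, $m_a=|\mathcal B|$ and $\ell=m_e+m_a$, and let $A(x)\in\mathbb{R}^{\ell\times n}$ be the matrix with rows $\nabla h_i(x)^\top$ ($i\in\mathcal B$) and $\nabla g_j(x)^\top$ ($1\le j\le m_e$). Assume that * $\nabla^2_{xx}L$ is Lipschitz continuous near $(p^\star,v^\star)$; * $A(x^\star)$ has full row rank (so $\ell\le n$); * $z^\star_i>0$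 for all $i\in\mathcal B$; * $d^\top\nabla^2_{xx}L(p^\star,v^\star)\,d>0$ for all $d\neq 0$ with $A(x^\star)d=0$. At a point $(p,v)$ with $s,v>0$ put $\Xi=s^\top v/m_i$. Given $C>0$ and $\alpha\in(0,1)$, the point is called central if $s,v>0$, $\|\nabla_pL(p,v)\|\le C\,\Xi$ and $s_iv_i\ge\alpha\,\Xi$ for all $i$. For $\gamma>0$ put $\underline\sigma=\min(1/\Xi,\gamma)$ and $$K_\gamma=W+H^\top S^{-1}VH+\gamma\,G^\top G,$$ where $W=\nabla^2_{xx}L(p,v)$, $H=\nabla h(x)$ and $G=\nabla g(x)$ are Jacobians, $S=\operatorname{diag}(s)$ and $V=\operatorname{diag}(v)$. Then there is $r>0$ such that for all $C>0$ and $\alpha\in(0,1)$ there are constants $\xi_0,\gamma_0,b>0$ for which the following holds for every central point $(p,v)$ at Euclidean distance at most $r$ from $(p^\star,v^\star)$ with $\Xi\le\xi_0$, and for every $\gamma\ge\gamma_0$. 1. There is a decomposition $$K_\gamma=\begin{bmatrix}U_L&U_S\end{bmatrix}\begin{bmatrix}\Sigma_L&0\\0&\Sigma_S\end{bmatrix}\begin{bmatrix}U_L^\top\\U_S^\top\end{bmatrix},$$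 where $\Sigma_L=\operatorname{diag}(\sigma_1,\dots,\sigma_\ell)$, $\Sigma_S=\operatorname{diag}(\sigma_{\ell+1},\dots,\sigma_n)$, $\sigma_1\ge\dots\ge\sigma_n$, and $U_L\in\mathbb{R}^{n\times\ell}$, $U_S\in\mathbb{R}^{n\times(n-\ell)}$ satisfy $U_L^\top U_L=I$, $U_S^\top U_S=I$ and $U_L^\top U_S=0$. 2. Every such decomposition has $\sigma_n>0$ (if $n\ge 1$), and if $0<\ell<n$ then $$\frac{\sigma_1}{\sigma_\ell}\le\frac{b}{\underline\sigma}\,\frac{\sigma_1}{\sigma_n},\qquad\frac{\sigma_{\ell+1}}{\sigma_n}\le\frac{b}{\underline\sigma}\,\frac{\sigma_1}{\sigma_n}.$$ Thus the condition numbers of $\Sigma_L$ and of $\Sigma_S$ are both much smaller than that of $K_\gamma$ as $\Xi\to0$ and $\gamma\to\infty$. 3. For every such decomposition there are $Y\in\mathbb{R}^{n\times\ell}$ and $Z\in\mathbb{R}^{n\times(n-\ell)}$ whose columns are orthonormal bases of the row space and of the null space of $A(x)$ respectively, such that in the 2-norm $$\|U_L-Y\|\le b\,\underline\sigma^{-1},\qquad\|U_S-Z\|\le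 b\,\underline\sigma^{-1}.$$ -/

import Mathlib

open scoped Matrix Matrix.Norms.L2Operator

/-- The nonlinear program `min f(x)` subject to `g(x) = 0`, `h(x) ≤ 0`, where `x ∈ ℝⁿ` is free
(bounds on `x` are part of `h`), with twice continuously differentiable data. -/
structure NLP (n me mi : ℕ) where
  f : EuclideanSpace ℝ (Fin n) → ℝ
  g : EuclideanSpace ℝ (Fin n) → EuclideanSpace ℝ (Fin me)
  h : EuclideanSpace ℝ (Fin n) → EuclideanSpace ℝ (Fin mi)
  contDiff_f : ContDiff ℝ 2 f
  contDiff_g : ContDiff ℝ 2 g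
  contDiff_h : ContDiff ℝ 2 h

/-- A primal-dual point `(p, v)` with `p = (x, s, y, z)`: primal variable, slack, multipliers of
`g(x) = 0` and of `h(x) + s = 0`, and multiplier `v` of the bound `s ≥ 0`. -/
@[ext]
structure PDPoint (n me mi : ℕ) where
  x : EuclideanSpace ℝ (Fin n)
  s : EuclideanSpace ℝ (Fin mi)
  y : EuclideanSpace ℝ (Fin me)
  z : EuclideanSpace ℝ (Fin mi)
  v : EuclideanSpace ℝ (Fin mi)

noncomputable section

namespace PDPoint

variable {n me mi : ℕ}

/-- The Euclidean distance between two primal-dual points. -/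
def edist (w w' : PDPoint n me mi) : ℝ :=
  Real.sqrt (‖w.x - w'.x‖ ^ 2 + ‖w.s - w'.s‖ ^ 2 + ‖w.y - w'.y‖ ^ 2 + ‖w.z - w'.z‖ ^ 2
    + ‖w.v - w'.v‖ ^ 2)

/-- The duality measure `Ξ(s, v) = sᵀ v / mᵢ`. -/
def dualityMeasure (w : PDPoint n me mi) : ℝ := (∑ i, w.s i * w.v i) / (mi : ℝ)

/-- `min (1 / Ξ, γ)`. -/
def sigmaLow (w : PDPoint n me mi) (γ : ℝ) : ℝ := min (1 / w.dualityMeasure) γ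

end PDPoint

/-- The Jacobian matrix of `F : ℝⁿ → ℝᵐ` at `x`. -/
def jacobianMatrix {n m : ℕ} (F : EuclideanSpace ℝ (Fin n) → EuclideanSpace ℝ (Fin m))
    (x : EuclideanSpace ℝ (Fin n)) : Matrix (Fin m) (Fin n) ℝ :=
  Matrix.of fun i j => fderiv ℝ F x (EuclideanSpace.single j 1) i

namespace NLP

variable {n me mi : ℕ} (P : NLP n me mi)

/-- The Lagrangian `f(x) + yᵀ g(x) + zᵀ (h(x) + s) - vᵀ s`. -/
def lagrangian (w : PDPoint n me mi) : ℝ :=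
  P.f w.x + inner ℝ w.y (P.g w.x) + inner ℝ w.z (P.h w.x + w.s) - inner ℝ w.v w.s

/-- The partial gradient of the Lagrangian in `x`. -/
def gradX (w : PDPoint n me mi) : EuclideanSpace ℝ (Fin n) :=
  gradient (fun x => P.lagrangian { w with x := x }) w.x

/-- The partial gradient of the Lagrangian in `s`. -/
def gradS (w : PDPoint n me mi) : EuclideanSpace ℝ (Fin mi) :=
  gradient (fun s => P.lagrangian { w with s := s }) w.s

/-- The partial gradient of the Lagrangian in `y`. -/
def gradY (w : PDPoint n me mi) : EuclideanSpace ℝ (Fin me) :=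
  gradient (fun y => P.lagrangian { w with y := y }) w.y

/-- The partial gradient of the Lagrangian in `z`. -/
def gradZ (w : PDPoint n me mi) : EuclideanSpace ℝ (Fin mi) :=
  gradient (fun z => P.lagrangian { w with z := z }) w.z

/-- The Euclidean norm of the gradient of the Lagrangian in `p = (x, s, y, z)`. -/
def gradNorm (w : PDPoint n me mi) : ℝ :=
  Real.sqrt (‖P.gradX w‖ ^ 2 + ‖P.gradS w‖ ^ 2 + ‖P.gradY w‖ ^ 2 + ‖P.gradZ w‖ ^ 2)

/-- The Hessian `W` of the Lagrangian in `x`: the Jacobian of its gradient in `x`. -/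
def hessian (w : PDPoint n me mi) : Matrix (Fin n) (Fin n) ℝ :=
  jacobianMatrix (fun x => P.gradX { w with x := x }) w.x

/-- The active set `{i | hᵢ(x) = 0}`. -/
def activeSet (x : EuclideanSpace ℝ (Fin n)) : Finset (Fin mi) :=
  open Classical in Finset.univ.filter fun i => P.h x i = 0

/-- The Jacobian at `x` of the equality constraints and of the inequality constraints in `B`. -/
def activeJacobian (B : Finset (Fin mi)) (x : EuclideanSpace ℝ (Fin n)) :
    Matrix (B ⊕ Fin me) (Fin n) ℝ :=
  Matrix.fromRows ((jacobianMatrix P.h x).submatrix Subtype.val id) (jacobianMatrix P.g x)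

/-- The KKT conditions of the problem with slacks. -/
structure IsKKT (w : PDPoint n me mi) : Prop where
  gradX_eq : P.gradX w = 0
  gradS_eq : P.gradS w = 0
  eq_feasible : P.g w.x = 0
  ineq_feasible : P.h w.x + w.s = 0
  s_nonneg : ∀ i, 0 ≤ w.s i
  v_nonneg : ∀ i, 0 ≤ w.v i
  complementary : ∀ i, w.s i * w.v i = 0

/-- A regular KKT point. -/
structure IsRegularSolution (w : PDPoint n me mi) : Prop where
  kkt : P.IsKKT w
  /-- The Hessian of the Lagrangian is Lipschitz continuous near `w`. -/
  lipschitz : ∃ ρ > (0 : ℝ), ∃ c : ℝ, ∀ w₁ w₂ : PDPoint n me mi,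
    w₁.edist w ≤ ρ → w₂.edist w ≤ ρ → ‖P.hessian w₁ - P.hessian w₂‖ ≤ c * w₁.edist w₂
  /-- Linear independence constraint qualification. -/
  licq : LinearIndependent ℝ (P.activeJacobian (P.activeSet w.x) w.x).row
  /-- Strict complementarity. -/
  scs : ∀ i ∈ P.activeSet w.x, 0 < w.z i
  /-- Second-order sufficiency. -/
  sosc : ∀ d : Fin n → ℝ, P.activeJacobian (P.activeSet w.x) w.x *ᵥ d = 0 → d ≠ 0 →
    0 < d ⬝ᵥ P.hessian w *ᵥ d

/-- The centrality conditions with constants `C` and `α`. -/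
structure IsCentral (C α : ℝ) (w : PDPoint n me mi) : Prop where
  grad_le : P.gradNorm w ≤ C * w.dualityMeasure
  s_pos : ∀ i, 0 < w.s i
  v_pos : ∀ i, 0 < w.v i
  le_mul : ∀ i, α * w.dualityMeasure ≤ w.s i * w.v i

/-- The condensed matrix `K_γ = W + Hᵀ S⁻¹ V H + γ Gᵀ G`. -/
def condensed (γ : ℝ) (w : PDPoint n me mi) : Matrix (Fin n) (Fin n) ℝ :=
  P.hessian w
    + (jacobianMatrix P.h w.x)ᵀ * Matrix.diagonal (fun i => w.v i / w.s i) * jacobianMatrix P.h w.x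
    + γ • ((jacobianMatrix P.g w.x)ᵀ * jacobianMatrix P.g w.x)

/-- `ℓ = mₑ + mₐ`: the number of equality constraints plus the number of inequality constraints
that are active at `x`. -/
def numActive (x : EuclideanSpace ℝ (Fin n)) : ℕ := me + (P.activeSet x).card

end NLP

/-- `K = [U_L U_S] diag(Σ_L, Σ_S) [U_L U_S]ᵀ` with `Σ_L = diag(σ₁, …, σ_ℓ)`,
`Σ_S = diag(σ_{ℓ+1}, …, σ_n)`, `σ₁ ≥ … ≥ σ_n`, and `[U_L U_S]` having orthonormal columns
(entries of `σ` are numbered from zero in the code). -/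
structure IsSpectralSplit {n l : ℕ} (hl : l ≤ n) (K : Matrix (Fin n) (Fin n) ℝ)
    (σ : Fin n → ℝ) (UL : Matrix (Fin n) (Fin l) ℝ) (US : Matrix (Fin n) (Fin (n - l)) ℝ) :
    Prop where
  antitone : Antitone σ
  orthoL : ULᵀ * UL = 1
  orthoS : USᵀ * US = 1
  orthoLS : ULᵀ * US = 0
  eq : K = Matrix.fromCols UL US *
    Matrix.fromBlocks
      (Matrix.diagonal fun i : Fin l => σ (Fin.castLE hl i)) 0
      0 (Matrix.diagonal fun j : Fin (n - l) =>
        σ (Fin.cast (Nat.add_sub_of_le hl) (Fin.natAdd l j))) *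
    Matrix.fromRows ULᵀ USᵀ

end

/-! ### The spectral norm of real matrices -/

section NormBounds

variable {k m n : Type*} [Fintype k] [Fintype m] [Fintype n]

/-! Write `K_γ = M + Aᵀ D A`, where `A` is the active Jacobian at `x`, `D` carries the weights `vᵢ /
sᵢ` of the active inequalities and `γ` for the equalities, and `M` (`boundedPart`) collects the
Hessian and the inactive inequalities. Near the solution `‖M‖ ≤ κ` and `A Aᵀ ≥ m`, while every entry
of `D` is at least `t`, a fixed multiple of `sigmaLow`.

By the min-max principle, the row space of `A` forces `ℓ` eigenvalues to be at least `t m - κ`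
(`le_large`), and the kernel of `A`, on which `K_γ` acts as the form of `M`, forces the others to be
at most `κ` (`small_le`). Comparing the two groups yields both quotient bounds. Positivity is
Finsler's lemma, which needs `t` only above a fixed threshold.

For the subspaces, let `Q` be the orthogonal projection onto the kernel of `A`. Since `Q Aᵀ = 0`,
the equation `K U_L = U_L Σ_L` gives `Q U_L = Q M U_L Σ_L⁻¹`, of size `O(κ / (t m))`. Polar factors
then turn nearness to a subspace into nearness to an orthonormal basis of it. Only lower bounds on
`D` enter, so `γ` may be arbitrarily large. -/

theorem norm_toLp_sq_eq_dotProduct (x : n → ℝ) : ‖WithLp.toLp 2 x‖ ^ 2 = x ⬝ᵥ x := by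
  rw [EuclideanSpace.norm_sq_eq]
  simp [dotProduct, sq]

theorem norm_transpose_eq [DecidableEq m] [DecidableEq n] (A : Matrix m n ℝ) : ‖Aᵀ‖ = ‖A‖ := by
  rw [← Matrix.conjTranspose_eq_transpose_of_trivial]
  exact Matrix.l2_opNorm_conjTranspose A

theorem norm_transpose_mul_self [DecidableEq n] (A : Matrix m n ℝ) : ‖Aᵀ * A‖ = ‖A‖ * ‖A‖ := by
  rw [← Matrix.conjTranspose_eq_transpose_of_trivial]
  exact Matrix.l2_opNorm_conjTranspose_mul_self A

theorem norm_one_matrix_le [DecidableEq n] : ‖(1 : Matrix n n ℝ)‖ ≤ 1 := by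
  rw [← Matrix.diagonal_one, Matrix.l2_opNorm_diagonal, pi_norm_le_iff_of_nonneg zero_le_one]
  simp

theorem mulVec_dotProduct_mulVec_le [DecidableEq n] (A : Matrix m n ℝ) (x : n → ℝ) :
    (A *ᵥ x) ⬝ᵥ (A *ᵥ x) ≤ ‖A‖ ^ 2 * (x ⬝ᵥ x) := by
  have h := Matrix.l2_opNorm_mulVec A (WithLp.toLp 2 x)
  rw [← norm_toLp_sq_eq_dotProduct, ← norm_toLp_sq_eq_dotProduct, ← mul_pow]
  exact pow_le_pow_left₀ (norm_nonneg _) h 2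

theorem abs_dotProduct_mulVec_le [DecidableEq n] (A : Matrix n n ℝ) (x : n → ℝ) :
    |x ⬝ᵥ A *ᵥ x| ≤ ‖A‖ * (x ⬝ᵥ x) := by
  have h := Matrix.l2_opNorm_mulVec A (WithLp.toLp 2 x)
  have h2 := abs_real_inner_le_norm (WithLp.toLp 2 (A *ᵥ x)) (WithLp.toLp 2 x)
  rw [EuclideanSpace.inner_toLp_toLp, star_trivial] at h2
  rw [← norm_toLp_sq_eq_dotProduct]
  calc _ ≤ _ := h2
    _ ≤ (‖A‖ * ‖WithLp.toLp 2 x‖) * ‖WithLp.toLp 2 x‖ :=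
      mul_le_mul_of_nonneg_right h (norm_nonneg _)
    _ = _ := by ring

theorem norm_le_of_mulVec_dotProduct_le [DecidableEq n] {A : Matrix m n ℝ} {c : ℝ} (hc : 0 ≤ c)
    (h : ∀ x, (A *ᵥ x) ⬝ᵥ (A *ᵥ x) ≤ c ^ 2 * (x ⬝ᵥ x)) : ‖A‖ ≤ c := by
  rw [Matrix.l2_opNorm_def]
  refine ContinuousLinearMap.opNorm_le_bound _ hc fun x => ?_
  have := h x.ofLp
  rw [← norm_toLp_sq_eq_dotProduct, ← norm_toLp_sq_eq_dotProduct, ← mul_pow] at this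
  exact le_of_sq_le_sq this (by positivity)

theorem norm_le_one_of_transpose_mul_self [DecidableEq n] {U : Matrix m n ℝ} (h : Uᵀ * U = 1) : ‖U‖ ≤ 1 := by
  have := norm_transpose_mul_self U
  rw [h] at this
  nlinarith [norm_one_matrix_le (n := n), norm_nonneg U]

theorem norm_le_one_of_symm_idempotent [DecidableEq n] {P : Matrix n n ℝ} (hs : Pᵀ = P) (hi : P * P = P) :
    ‖P‖ ≤ 1 := by
  have := norm_transpose_mul_self P
  rw [hs, hi] at this
  nlinarith [norm_nonneg P]

theorem matrix_norm_mul_le_of_le [DecidableEq m] [DecidableEq n] {A : Matrix k m ℝ} {B : Matrix m n ℝ} {a b : ℝ}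
    (hA : ‖A‖ ≤ a) (hB : ‖B‖ ≤ b) : ‖A * B‖ ≤ a * b :=
  (Matrix.l2_opNorm_mul A B).trans
    (mul_le_mul hA hB (norm_nonneg _) ((norm_nonneg _).trans hA))

theorem dotProduct_self_nonneg' (x : n → ℝ) : 0 ≤ x ⬝ᵥ x := by
  simpa using dotProduct_star_self_nonneg x

theorem dotProduct_self_pos {x : n → ℝ} (hx : x ≠ 0) : 0 < x ⬝ᵥ x := by
  rw [← norm_toLp_sq_eq_dotProduct]
  have : WithLp.toLp 2 x ≠ 0 := by simpa using hx
  positivity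

theorem dotProduct_transpose_mul_mulVec (A : Matrix m n ℝ) (x : n → ℝ) :
    x ⬝ᵥ (Aᵀ * A) *ᵥ x = (A *ᵥ x) ⬝ᵥ (A *ᵥ x) := by
  rw [← Matrix.mulVec_mulVec, Matrix.dotProduct_mulVec, Matrix.vecMul_transpose]

theorem dotProduct_transpose_mul_diagonal_mul_mulVec [DecidableEq m] (A : Matrix m n ℝ) (d : m → ℝ) (x : n → ℝ) :
    x ⬝ᵥ (Aᵀ * Matrix.diagonal d * A) *ᵥ x = ∑ i, d i * (A *ᵥ x) i ^ 2 := by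
  rw [Matrix.mul_assoc, ← Matrix.mulVec_mulVec, Matrix.dotProduct_mulVec, Matrix.vecMul_transpose,
    ← Matrix.mulVec_mulVec]
  simp only [dotProduct, Matrix.mulVec_diagonal]
  exact Finset.sum_congr rfl fun i _ => by ring

theorem le_dotProduct_transpose_mul_diagonal_mul_mulVec [DecidableEq m] (A : Matrix m n ℝ) {d : m → ℝ} {t : ℝ}
    (h : ∀ i, t ≤ d i) (x : n → ℝ) :
    t * ((A *ᵥ x) ⬝ᵥ (A *ᵥ x)) ≤ x ⬝ᵥ (Aᵀ * Matrix.diagonal d * A) *ᵥ x := by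
  rw [dotProduct_transpose_mul_diagonal_mul_mulVec, dotProduct, Finset.mul_sum]
  refine Finset.sum_le_sum fun i _ => ?_
  nlinarith [sq_nonneg ((A *ᵥ x) i), h i]

end NormBounds

/-! ### Orthonormal bases close to given orthonormal columns -/

section Polar

variable {k n : Type*} [Fintype k] [Fintype n] [DecidableEq k]

open scoped MatrixOrder in
theorem Matrix.PosSemidef.exists_posSemidef_mul_self {A : Matrix k k ℝ} (hA : A.PosSemidef) :
    ∃ R : Matrix k k ℝ, R.PosSemidef ∧ R * R = A :=
  ⟨CFC.sqrt A, Matrix.nonneg_iff_posSemidef.1 (CFC.sqrt_nonneg _),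
    CFC.sqrt_mul_sqrt_self _ hA.nonneg⟩

/-- The polar factor of a matrix with nearly orthonormal columns is close to it. -/
theorem exists_orthonormal_cols_near {T : Matrix n k ℝ} {ε : ℝ} (hε : ε < 1)
    (hT : ‖Tᵀ * T - 1‖ ≤ ε) :
    ∃ (Q : Matrix n k ℝ) (R : Matrix k k ℝ), Q = T * R ∧ Qᵀ * Q = 1 ∧ ‖T - Q‖ ≤ ε := by
  have hps : (Tᵀ * T).PosSemidef := by
    rw [← Matrix.conjTranspose_eq_transpose_of_trivial]
    exact Matrix.posSemidef_conjTranspose_mul_self T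
  obtain ⟨R, hRps, hRR⟩ := hps.exists_posSemidef_mul_self
  have hRt : Rᵀ = R := by
    have := hRps.isHermitian.eq
    rwa [Matrix.conjTranspose_eq_transpose_of_trivial] at this
  have hTu : IsUnit (Tᵀ * T) := by
    have : Tᵀ * T = 1 - (1 - Tᵀ * T) := by abel
    rw [this]
    refine isUnit_one_sub_of_norm_lt_one (lt_of_le_of_lt ?_ hε)
    rwa [norm_sub_rev]
  have hRu : IsUnit R.det := by
    rw [Matrix.isUnit_iff_isUnit_det, ← hRR, Matrix.det_mul] at hTu
    exact isUnit_of_mul_isUnit_left hTu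
  have hQR : T * R⁻¹ * R = T := by
    rw [Matrix.mul_assoc, Matrix.nonsing_inv_mul _ hRu, Matrix.mul_one]
  have hQ : (T * R⁻¹)ᵀ * (T * R⁻¹) = 1 := by
    rw [Matrix.transpose_mul, Matrix.transpose_nonsing_inv, hRt, Matrix.mul_assoc,
      ← Matrix.mul_assoc Tᵀ, ← hRR, Matrix.mul_assoc R, Matrix.mul_nonsing_inv _ hRu,
      Matrix.mul_one, Matrix.nonsing_inv_mul _ hRu]
  -- The factor is exported so that `P * T = T` is inherited by the polar factor.
  refine ⟨T * R⁻¹, R⁻¹, rfl, hQ, ?_⟩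
  have hε0 : 0 ≤ ε := (norm_nonneg _).trans hT
  have hR1 : ‖R - 1‖ ≤ ε := by
    -- `TᵀT - 1 = (R + 1)(R - 1)`, and `R + 1` does not shrink vectors because `R` is positive
    -- semidefinite.
    refine norm_le_of_mulVec_dotProduct_le hε0 fun x => ?_
    set y := (R - 1) *ᵥ x with hy
    have h1 : (Tᵀ * T - 1) *ᵥ x = R *ᵥ y + y := by
      rw [← hRR, hy, Matrix.mulVec_mulVec, ← Matrix.add_mulVec]
      congr 1
      noncomm_ring
    have h2 := mulVec_dotProduct_mulVec_le (Tᵀ * T - 1) x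
    have h3 : ‖Tᵀ * T - 1‖ ^ 2 ≤ ε ^ 2 := pow_le_pow_left₀ (norm_nonneg _) hT 2
    have h4 : 0 ≤ y ⬝ᵥ R *ᵥ y := by simpa using hRps.dotProduct_mulVec_nonneg y
    rw [h1] at h2
    simp only [add_dotProduct, dotProduct_add] at h2
    rw [dotProduct_comm (R *ᵥ y) y] at h2
    nlinarith [dotProduct_self_nonneg' (R *ᵥ y), dotProduct_self_nonneg' x]
  have : T - T * R⁻¹ = (T * R⁻¹) * (R - 1) := by
    rw [Matrix.mul_sub, hQR, Matrix.mul_one]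
  rw [this]
  simpa using matrix_norm_mul_le_of_le (norm_le_one_of_transpose_mul_self hQ) hR1

/-- Orthonormal columns at distance at most `ε < 1` from the range of an orthogonal projection
are within `2 ε` of orthonormal columns in that range. -/
theorem exists_orthonormal_cols_in_range [DecidableEq n] {P : Matrix n n ℝ} (hs : Pᵀ = P) (hi : P * P = P)
    {U : Matrix n k ℝ} (hU : Uᵀ * U = 1) {ε : ℝ} (hε : ε < 1) (hd : ‖U - P * U‖ ≤ ε) :
    ∃ Q : Matrix n k ℝ, Qᵀ * Q = 1 ∧ P * Q = Q ∧ ‖U - Q‖ ≤ 2 * ε := by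
  have hε0 : 0 ≤ ε := (norm_nonneg _).trans hd
  -- Pythagoras: the defect of orthonormality of `P U` is quadratic in `U - P U`, hence at most `ε²
  -- ≤ ε`.
  have key : (P * U)ᵀ * (P * U) - 1 = -((U - P * U)ᵀ * (U - P * U)) := by
    have h1 : Uᵀ * P * (P * U) = Uᵀ * P * U := by
      rw [Matrix.mul_assoc, ← Matrix.mul_assoc P, hi, Matrix.mul_assoc]
    rw [Matrix.transpose_sub, Matrix.transpose_mul, hs, Matrix.sub_mul, Matrix.mul_sub,
      Matrix.mul_sub, h1, hU, ← Matrix.mul_assoc]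
    abel
  have hn : ‖(P * U)ᵀ * (P * U) - 1‖ ≤ ε := by
    rw [key, norm_neg, norm_transpose_mul_self]
    nlinarith [norm_nonneg (U - P * U)]
  obtain ⟨Q, R, hQ, hQQ, hTQ⟩ := exists_orthonormal_cols_near hε hn
  refine ⟨Q, hQQ, ?_, ?_⟩
  · rw [hQ, ← Matrix.mul_assoc, ← Matrix.mul_assoc, hi]
  · have := norm_add_le (U - P * U) (P * U - Q)
    rw [sub_add_sub_cancel] at this
    linarith

theorem linearIndependent_col_of_transpose_mul_self {Q : Matrix n k ℝ} (h : Qᵀ * Q = 1) :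
    LinearIndependent ℝ Q.col := by
  rw [← Matrix.mulVec_injective_iff]
  intro x y hxy
  have := congrArg (Qᵀ *ᵥ ·) hxy
  simpa [Matrix.mulVec_mulVec, h] using this

theorem span_col_eq_of_mem {Q : Matrix n k ℝ} (h : Qᵀ * Q = 1) {V : Submodule ℝ (n → ℝ)}
    (hV : ∀ j, Q.col j ∈ V) (hf : Module.finrank ℝ V = Fintype.card k) :
    Submodule.span ℝ (Set.range Q.col) = V := by
  refine Submodule.eq_of_le_of_finrank_eq (Submodule.span_le.2 ?_) ?_
  · rintro _ ⟨j, rfl⟩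
    exact hV j
  · rw [hf, finrank_span_eq_card (linearIndependent_col_of_transpose_mul_self h)]

/-- Writing `P = Q B`, orthonormality gives `B = Qᵀ P`, and transposing `P Q = Q` gives `Qᵀ P = Qᵀ`.
-/
theorem eq_mul_transpose_of_span_col_eq {Q : Matrix n k ℝ} {P : Matrix n n ℝ} (hs : Pᵀ = P)
    (hQ : Qᵀ * Q = 1) (hPQ : P * Q = Q)
    (hP : ∀ j, P.col j ∈ Submodule.span ℝ (Set.range Q.col)) : P = Q * Qᵀ := by
  have h : ∀ j, ∃ b, Q *ᵥ b = P.col j := fun j => by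
    have := hP j
    rw [← Matrix.range_mulVecLin] at this
    exact this
  choose b hb using h
  have hB : P = Q * (Matrix.of b)ᵀ := by
    ext i j
    exact (congrFun (hb j) i).symm
  have hQt : Qᵀ * P = Qᵀ := by
    have := congrArg Matrix.transpose hPQ
    rwa [Matrix.transpose_mul, hs] at this
  have : (Matrix.of b)ᵀ = Qᵀ := by
    rw [← hQt, hB, ← Matrix.mul_assoc, hQ, Matrix.one_mul]
  rw [← this]
  exact hB

end Polar

/-! ### Spectral decompositions -/

section Spectral

variable {n : ℕ}

/-- The dimension count behind the min-max principle: fewer linear conditions than dimensions leave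
a nonzero solution. -/
theorem exists_ne_zero_mem_transpose_mulVec_eq_zero (U : Matrix (Fin n) (Fin n) ℝ)
    (s : Finset (Fin n)) (V : Submodule ℝ (Fin n → ℝ)) (h : s.card < Module.finrank ℝ V) :
    ∃ x ∈ V, x ≠ 0 ∧ ∀ i ∈ s, (Uᵀ *ᵥ x) i = 0 := by
  let F : V →ₗ[ℝ] (s → ℝ) :=
    (LinearMap.funLeft ℝ ℝ (Subtype.val : s → Fin n)).comp (Uᵀ.mulVecLin.comp V.subtype)
  have hk : F.ker ≠ ⊥ := LinearMap.ker_ne_bot_of_finrank_lt (by simpa using h)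
  obtain ⟨x, hx, hx0⟩ := Submodule.exists_mem_ne_zero_of_ne_bot hk
  refine ⟨x, x.2, by simpa using hx0, fun i hi => ?_⟩
  exact congrFun (LinearMap.mem_ker.1 hx) ⟨i, hi⟩

variable {U K : Matrix (Fin n) (Fin n) ℝ} {σ : Fin n → ℝ}

theorem dotProduct_mulVec_eq_sum (hK : K = U * Matrix.diagonal σ * Uᵀ) (x : Fin n → ℝ) :
    x ⬝ᵥ K *ᵥ x = ∑ i, σ i * (Uᵀ *ᵥ x) i ^ 2 := by
  rw [hK]
  simpa using dotProduct_transpose_mul_diagonal_mul_mulVec Uᵀ σ x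

theorem dotProduct_self_eq_sum (hU : Uᵀ * U = 1) (x : Fin n → ℝ) :
    x ⬝ᵥ x = ∑ i, (Uᵀ *ᵥ x) i ^ 2 := by
  have := dotProduct_mulVec_eq_sum (U := U) (K := 1) (σ := fun _ => 1)
    (by rw [Matrix.diagonal_one, Matrix.mul_one, mul_eq_one_comm.1 hU]) x
  simpa using this

/-- One half of Courant–Fischer: some nonzero vector of `V` is orthogonal to the first `j`
eigenvectors, so its Rayleigh quotient is at most `σ j`. Counting from zero, `Iio j` has `j`
elements, hence the strict inequality in `hj`. -/
theorem le_eigenvalue_of_le_on_submodule (hσ : Antitone σ) (hU : Uᵀ * U = 1)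
    (hK : K = U * Matrix.diagonal σ * Uᵀ) (V : Submodule ℝ (Fin n → ℝ)) {c : ℝ} {j : Fin n}
    (hj : (j : ℕ) < Module.finrank ℝ V) (h : ∀ x ∈ V, c * (x ⬝ᵥ x) ≤ x ⬝ᵥ K *ᵥ x) : c ≤ σ j := by
  obtain ⟨x, hx, hx0, hz⟩ :=
    exists_ne_zero_mem_transpose_mulVec_eq_zero U (Finset.Iio j) V (by simpa using hj)
  refine le_of_mul_le_mul_right ((h x hx).trans ?_) (dotProduct_self_pos hx0)
  rw [dotProduct_mulVec_eq_sum hK, dotProduct_self_eq_sum hU, Finset.mul_sum]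
  refine Finset.sum_le_sum fun i _ => ?_
  by_cases hi : i < j
  · simp [hz i (by simpa using hi)]
  · exact mul_le_mul_of_nonneg_right (hσ (not_lt.1 hi)) (sq_nonneg _)

theorem eigenvalue_le_of_le_on_submodule (hσ : Antitone σ) (hU : Uᵀ * U = 1)
    (hK : K = U * Matrix.diagonal σ * Uᵀ) (V : Submodule ℝ (Fin n → ℝ)) {c : ℝ} {j : Fin n}
    (hj : n - 1 - j < Module.finrank ℝ V) (h : ∀ x ∈ V, x ⬝ᵥ K *ᵥ x ≤ c * (x ⬝ᵥ x)) :
    σ j ≤ c := by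
  obtain ⟨x, hx, hx0, hz⟩ :=
    exists_ne_zero_mem_transpose_mulVec_eq_zero U (Finset.Ioi j) V (by simpa using hj)
  refine le_of_mul_le_mul_right (le_trans ?_ (h x hx)) (dotProduct_self_pos hx0)
  rw [dotProduct_mulVec_eq_sum hK, dotProduct_self_eq_sum hU, Finset.mul_sum]
  refine Finset.sum_le_sum fun i _ => ?_
  by_cases hi : j < i
  · simp [hz i (by simpa using hi)]
  · exact mul_le_mul_of_nonneg_right (hσ (not_lt.1 hi)) (sq_nonneg _)

theorem eigenvalue_pos (hU : Uᵀ * U = 1) (hK : K = U * Matrix.diagonal σ * Uᵀ)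
    (h : ∀ x, x ≠ 0 → 0 < x ⬝ᵥ K *ᵥ x) (i : Fin n) : 0 < σ i := by
  have hUe : Uᵀ *ᵥ (U *ᵥ Pi.single i 1) = Pi.single i 1 := by
    rw [Matrix.mulVec_mulVec, hU, Matrix.one_mulVec]
  have hne : U *ᵥ Pi.single i 1 ≠ 0 := fun h0 => by
    rw [h0, Matrix.mulVec_zero] at hUe
    simpa using congrFun hUe i
  have := h _ hne
  rw [dotProduct_mulVec_eq_sum hK, hUe] at this
  simpa [Pi.single_apply] using this

end Spectral

/-! ### Passing between the two-block form and a full orthogonal diagonalization. -/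

section Split

variable {n l : ℕ}

/-- The column blocks of sizes `l` and `n - l` put together. -/
def blockEquiv (hl : l ≤ n) : Fin l ⊕ Fin (n - l) ≃ Fin n :=
  finSumFinEquiv.trans (finCongr (Nat.add_sub_of_le hl))

variable {hl : l ≤ n} {K : Matrix (Fin n) (Fin n) ℝ} {σ : Fin n → ℝ}

theorem fromBlocks_diagonal_eq_submatrix (hl : l ≤ n) (σ : Fin n → ℝ) :
    Matrix.fromBlocks (Matrix.diagonal fun i : Fin l => σ (Fin.castLE hl i)) 0
      0 (Matrix.diagonal fun j : Fin (n - l) =>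
        σ (Fin.cast (Nat.add_sub_of_le hl) (Fin.natAdd l j)))
      = (Matrix.diagonal σ).submatrix (blockEquiv hl) (blockEquiv hl) := by
  rw [Matrix.fromBlocks_diagonal, Matrix.submatrix_diagonal_equiv]
  congr 1
  ext (i | i) <;> rfl

theorem IsSpectralSplit.exists_orthogonal {UL : Matrix (Fin n) (Fin l) ℝ}
    {US : Matrix (Fin n) (Fin (n - l)) ℝ} (h : IsSpectralSplit hl K σ UL US) :
    ∃ U : Matrix (Fin n) (Fin n) ℝ, Uᵀ * U = 1 ∧ K = U * Matrix.diagonal σ * Uᵀ := by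
  refine ⟨(Matrix.fromCols UL US).submatrix id (blockEquiv hl).symm, ?_, ?_⟩
  · have h1 : (Matrix.fromCols UL US)ᵀ * Matrix.fromCols UL US = 1 := by
      rw [Matrix.transpose_fromCols, Matrix.fromRows_mul_fromCols, h.orthoL, h.orthoS, h.orthoLS]
      have := congrArg Matrix.transpose h.orthoLS
      rw [Matrix.transpose_mul, Matrix.transpose_transpose, Matrix.transpose_zero] at this
      rw [this, Matrix.fromBlocks_one]
    rw [Matrix.transpose_submatrix, ← Matrix.submatrix_mul _ _ _ _ _ Function.bijective_id, h1,
      Matrix.submatrix_one_equiv]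
  · have h2 : Matrix.diagonal σ = ((Matrix.diagonal σ).submatrix (blockEquiv hl)
        (blockEquiv hl)).submatrix (blockEquiv hl).symm (blockEquiv hl).symm := by
      simp
    rw [h2, Matrix.transpose_submatrix, Matrix.submatrix_mul_equiv, Matrix.submatrix_mul_equiv,
      Matrix.submatrix_id_id, ← fromBlocks_diagonal_eq_submatrix, Matrix.transpose_fromCols]
    exact h.eq

theorem IsSpectralSplit.mul_left_block {UL : Matrix (Fin n) (Fin l) ℝ}
    {US : Matrix (Fin n) (Fin (n - l)) ℝ} (h : IsSpectralSplit hl K σ UL US) :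
    K * UL = UL * Matrix.diagonal fun i : Fin l => σ (Fin.castLE hl i) := by
  have h1 := congrArg Matrix.transpose h.orthoLS
  rw [Matrix.transpose_mul, Matrix.transpose_transpose, Matrix.transpose_zero] at h1
  rw [h.eq, Matrix.mul_assoc, Matrix.fromRows_mul, h.orthoL, h1, Matrix.mul_assoc,
    Matrix.fromBlocks_mul_fromRows, Matrix.fromCols_mul_fromRows]
  simp

theorem exists_isSpectralSplit (hl : l ≤ n) (hK : Kᵀ = K) :
    ∃ σ UL US, IsSpectralSplit hl K σ UL US := by
  have hH : K.IsHermitian := by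
    rwa [Matrix.IsHermitian, Matrix.conjTranspose_eq_transpose_of_trivial]
  set E : Matrix (Fin n) (Fin n) ℝ := (hH.eigenvectorUnitary).1 with hE
  have hEE : Eᵀ * E = 1 := by
    have := Unitary.star_mul_self_of_mem hH.eigenvectorUnitary.2
    rwa [Matrix.star_eq_conjTranspose, Matrix.conjTranspose_eq_transpose_of_trivial] at this
  have hspec : K = E * Matrix.diagonal hH.eigenvalues * Eᵀ := by
    have := hH.spectral_theorem
    rw [Unitary.conjStarAlgAut_apply, Matrix.star_eq_conjTranspose,
      Matrix.conjTranspose_eq_transpose_of_trivial] at this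
    exact this
  -- Sorting the negatives increasingly lists the eigenvalues in decreasing order.
  set p := Tuple.sort (fun i => -hH.eigenvalues i) with hp
  have hmono := Tuple.monotone_sort (fun i => -hH.eigenvalues i)
  set e := (blockEquiv hl).trans p with he
  set F := E.submatrix id e with hF
  have hFF : Fᵀ * F = 1 := by
    rw [hF, Matrix.transpose_submatrix, ← Matrix.submatrix_mul _ _ _ _ _ Function.bijective_id,
      hEE, Matrix.submatrix_one_equiv]
  have hFc : F = Matrix.fromCols (F.submatrix id Sum.inl) (F.submatrix id Sum.inr) := by
    ext i (j | j) <;> rfl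
  have hblocks : Matrix.fromBlocks ((F.submatrix id Sum.inl)ᵀ * F.submatrix id Sum.inl)
      ((F.submatrix id Sum.inl)ᵀ * F.submatrix id Sum.inr)
      ((F.submatrix id Sum.inr)ᵀ * F.submatrix id Sum.inl)
      ((F.submatrix id Sum.inr)ᵀ * F.submatrix id Sum.inr) = Matrix.fromBlocks 1 0 0 1 := by
    rw [← Matrix.fromRows_mul_fromCols, ← Matrix.transpose_fromCols, ← hFc, hFF,
      Matrix.fromBlocks_one]
  rw [Matrix.fromBlocks_inj] at hblocks
  refine ⟨hH.eigenvalues ∘ p, F.submatrix id Sum.inl, F.submatrix id Sum.inr, ?_, hblocks.1,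
    hblocks.2.2.2, hblocks.2.1, ?_⟩
  · intro i j hij
    exact neg_le_neg_iff.1 (hmono hij)
  · rw [fromBlocks_diagonal_eq_submatrix, ← Matrix.transpose_fromCols, ← hFc]
    have : (Matrix.diagonal (hH.eigenvalues ∘ p)).submatrix (blockEquiv hl) (blockEquiv hl)
        = (Matrix.diagonal hH.eigenvalues).submatrix e e := by
      rw [Matrix.submatrix_diagonal_equiv, Matrix.submatrix_diagonal_equiv]
      rfl
    rw [this, hF, Matrix.transpose_submatrix, Matrix.submatrix_mul_equiv,
      Matrix.submatrix_mul_equiv, Matrix.submatrix_id_id]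
    exact hspec

end Split

/-! ### The range of the adjoint of a matrix with linearly independent rows -/

section RowSpace

variable {ι n : Type*} [Fintype ι] {A : Matrix ι n ℝ} {m : ℝ}

theorem mem_span_row_iff {x : n → ℝ} :
    x ∈ Submodule.span ℝ (Set.range A.row) ↔ ∃ c, Aᵀ *ᵥ c = x := by
  have : Submodule.span ℝ (Set.range A.row) = Aᵀ.mulVecLin.range :=
    (Matrix.range_mulVecLin Aᵀ).symm
  rw [this]
  rfl

variable [Fintype n]

theorem linearIndependent_row_of_le (hm : 0 < m)
    (hA : ∀ c, m * (c ⬝ᵥ c) ≤ (Aᵀ *ᵥ c) ⬝ᵥ (Aᵀ *ᵥ c)) : LinearIndependent ℝ A.row := by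
  have : LinearIndependent ℝ Aᵀ.col := by
    rw [← Matrix.mulVec_injective_iff]
    intro x y hxy
    have h := hA (x - y)
    rw [Matrix.mulVec_sub, sub_eq_zero.2 hxy, dotProduct_zero] at h
    by_contra hne
    have := dotProduct_self_pos (sub_ne_zero.2 hne)
    nlinarith
  exact this

/-- For `x = Aᵀ c`, Cauchy–Schwarz gives `|x|² = c · A x ≤ |c| |A x|`; with `m |c|² ≤ |x|²` a factor
`|x|²` cancels. -/
theorem le_mulVec_of_mem_span_row (hm : 0 < m)
    (hA : ∀ c, m * (c ⬝ᵥ c) ≤ (Aᵀ *ᵥ c) ⬝ᵥ (Aᵀ *ᵥ c)) {x : n → ℝ}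
    (hx : x ∈ Submodule.span ℝ (Set.range A.row)) :
    m * (x ⬝ᵥ x) ≤ (A *ᵥ x) ⬝ᵥ (A *ᵥ x) := by
  obtain ⟨c, rfl⟩ := mem_span_row_iff.1 hx
  set x := Aᵀ *ᵥ c with hx
  have h1 : x ⬝ᵥ x = c ⬝ᵥ (A *ᵥ x) := by
    rw [Matrix.dotProduct_mulVec, ← Matrix.mulVec_transpose, Matrix.transpose_transpose,
      dotProduct_comm]
  have h2 : (c ⬝ᵥ (A *ᵥ x)) ^ 2 ≤ (c ⬝ᵥ c) * ((A *ᵥ x) ⬝ᵥ (A *ᵥ x)) := by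
    have := Finset.sum_mul_sq_le_sq_mul_sq Finset.univ c (A *ᵥ x)
    simpa only [dotProduct, ← sq] using this
  have h3 := hA c
  have h4 := dotProduct_self_nonneg' (A *ᵥ x)
  rcases (dotProduct_self_nonneg' x).eq_or_lt with h0 | h0
  · rwa [← h0, mul_zero]
  · rw [← h1] at h2
    refine le_of_mul_le_mul_right ?_ h0
    nlinarith [mul_le_mul_of_nonneg_left h2 hm.le, mul_le_mul_of_nonneg_right h3 h4]

variable [DecidableEq ι]

theorem isUnit_det_mul_transpose (hm : 0 < m)
    (hA : ∀ c, m * (c ⬝ᵥ c) ≤ (Aᵀ *ᵥ c) ⬝ᵥ (Aᵀ *ᵥ c)) : IsUnit (A * Aᵀ).det := by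
  rw [← Matrix.isUnit_iff_isUnit_det, ← Matrix.mulVec_injective_iff_isUnit]
  intro x y hxy
  have hxy : (A * Aᵀ) *ᵥ x = (A * Aᵀ) *ᵥ y := hxy
  have h := hA (x - y)
  have h2 := dotProduct_transpose_mul_mulVec Aᵀ (x - y)
  rw [Matrix.transpose_transpose, Matrix.mulVec_sub, sub_eq_zero.2 hxy, dotProduct_zero] at h2
  rw [← h2] at h
  by_contra hne
  have := dotProduct_self_pos (sub_ne_zero.2 hne)
  nlinarith

/-- The orthogonal projection onto the row space. -/
noncomputable def rowProj (A : Matrix ι n ℝ) : Matrix n n ℝ := Aᵀ * ((A * Aᵀ)⁻¹ * A)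

theorem transpose_rowProj (A : Matrix ι n ℝ) : (rowProj A)ᵀ = rowProj A := by
  simp only [rowProj, Matrix.transpose_mul, Matrix.transpose_nonsing_inv,
    Matrix.transpose_transpose, Matrix.mul_assoc]

theorem mul_rowProj (h : IsUnit (A * Aᵀ).det) : A * rowProj A = A := by
  rw [rowProj, ← Matrix.mul_assoc, ← Matrix.mul_assoc, Matrix.mul_nonsing_inv _ h, Matrix.one_mul]

theorem rowProj_mul_self (h : IsUnit (A * Aᵀ).det) : rowProj A * rowProj A = rowProj A := by
  have h1 : rowProj A * rowProj A = Aᵀ * ((A * Aᵀ)⁻¹ * (A * rowProj A)) := by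
    simp only [rowProj, Matrix.mul_assoc]
  rw [h1, mul_rowProj h, rowProj]

theorem col_mem_span_row_of_rowProj_mul_eq {k : Type*} {Q : Matrix n k ℝ} (h : rowProj A * Q = Q)
    (j : k) : Q.col j ∈ Submodule.span ℝ (Set.range A.row) := by
  refine mem_span_row_iff.2 ⟨((A * Aᵀ)⁻¹ * A * Q).col j, ?_⟩
  conv_rhs => rw [← h, rowProj, Matrix.mul_assoc]
  rfl

theorem col_mem_ker_of_one_sub_rowProj_mul_eq [DecidableEq n] {k : Type*} {Q : Matrix n k ℝ}
    (hu : IsUnit (A * Aᵀ).det) (h : (1 - rowProj A) * Q = Q) (j : k) :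
    Q.col j ∈ LinearMap.ker A.mulVecLin := by
  have : A * Q = 0 := by
    rw [← h, ← Matrix.mul_assoc, Matrix.mul_sub, mul_rowProj hu, Matrix.mul_one, sub_self,
      Matrix.zero_mul]
  ext i
  exact congrFun (congrFun this i) j

end RowSpace

/-! ### Perturbation of the spectral decomposition of `M + Aᵀ D A` with `D` large -/

section Core

variable {n l : ℕ} {hl : l ≤ n} {ι : Type*} [Fintype ι]
  {M K : Matrix (Fin n) (Fin n) ℝ} {A : Matrix ι (Fin n) ℝ} {d : ι → ℝ} {κ m t : ℝ}
  {σ : Fin n → ℝ} {UL : Matrix (Fin n) (Fin l) ℝ} {US : Matrix (Fin n) (Fin (n - l)) ℝ}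

theorem finrank_ker_mulVecLin (hcard : Fintype.card ι = l) (hA : LinearIndependent ℝ A.row) :
    Module.finrank ℝ (LinearMap.ker A.mulVecLin) = n - l := by
  have h1 := A.mulVecLin.finrank_range_add_finrank_ker
  have h2 : Module.finrank ℝ (LinearMap.range A.mulVecLin) = l :=
    (LinearIndependent.rank_matrix hA).trans hcard
  rw [h2, Module.finrank_fin_fun] at h1
  omega

variable [DecidableEq ι]

theorem IsSpectralSplit.le_large (h : IsSpectralSplit hl K σ UL US)
    (hcard : Fintype.card ι = l) (hK : K = M + Aᵀ * Matrix.diagonal d * A) (hM : ‖M‖ ≤ κ)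
    (ht : 0 ≤ t) (hd : ∀ i, t ≤ d i) (hm : 0 < m)
    (hA : ∀ c, m * (c ⬝ᵥ c) ≤ (Aᵀ *ᵥ c) ⬝ᵥ (Aᵀ *ᵥ c)) {j : Fin n} (hj : (j : ℕ) < l) :
    t * m - κ ≤ σ j := by
  obtain ⟨U, hU, hKU⟩ := h.exists_orthogonal
  refine le_eigenvalue_of_le_on_submodule h.antitone hU hKU
    (Submodule.span ℝ (Set.range A.row)) ?_ fun x hx => ?_
  · rwa [finrank_span_eq_card (linearIndependent_row_of_le hm hA), hcard]
  · have h1 := le_mulVec_of_mem_span_row hm hA hx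
    have h2 := le_dotProduct_transpose_mul_diagonal_mul_mulVec A hd x
    have h3 := neg_le_of_abs_le (abs_dotProduct_mulVec_le M x)
    rw [hK, Matrix.add_mulVec, dotProduct_add]
    nlinarith [dotProduct_self_nonneg' x, mul_le_mul_of_nonneg_left h1 ht]

theorem IsSpectralSplit.small_le (h : IsSpectralSplit hl K σ UL US)
    (hcard : Fintype.card ι = l) (hK : K = M + Aᵀ * Matrix.diagonal d * A) (hM : ‖M‖ ≤ κ)
    (hm : 0 < m) (hA : ∀ c, m * (c ⬝ᵥ c) ≤ (Aᵀ *ᵥ c) ⬝ᵥ (Aᵀ *ᵥ c)) {j : Fin n}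
    (hj : l ≤ (j : ℕ)) : σ j ≤ κ := by
  obtain ⟨U, hU, hKU⟩ := h.exists_orthogonal
  refine eigenvalue_le_of_le_on_submodule h.antitone hU hKU
    (LinearMap.ker A.mulVecLin) ?_ fun x hx => ?_
  · rw [finrank_ker_mulVecLin hcard (linearIndependent_row_of_le hm hA)]
    omega
  · have hx : A *ᵥ x = 0 := hx
    have h3 := le_of_abs_le (abs_dotProduct_mulVec_le M x)
    rw [hK, Matrix.add_mulVec, dotProduct_add, dotProduct_transpose_mul_diagonal_mul_mulVec, hx]
    simp only [Pi.zero_apply, ne_eq, OfNat.ofNat_ne_zero, not_false_eq_true, zero_pow, mul_zero,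
      Finset.sum_const_zero, add_zero]
    nlinarith [dotProduct_self_nonneg' x]

/-- The complementary projection annihilates `Aᵀ`, so the large weights disappear from the
eigenvector equation, and dividing by eigenvalues at least `c` leaves `κ / c`. -/
theorem IsSpectralSplit.norm_left_sub_rowProj_le (h : IsSpectralSplit hl K σ UL US)
    (hK : K = M + Aᵀ * Matrix.diagonal d * A) (hM : ‖M‖ ≤ κ) (hu : IsUnit (A * Aᵀ).det) {c : ℝ}
    (hc : 0 < c) (hσ : ∀ i : Fin l, c ≤ σ (Fin.castLE hl i)) :
    ‖UL - rowProj A * UL‖ ≤ κ / c := by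
  set Q := 1 - rowProj A with hQ
  have hQs : Qᵀ = Q := by rw [hQ, Matrix.transpose_sub, transpose_rowProj, Matrix.transpose_one]
  have hQi : Q * Q = Q := by
    rw [hQ, Matrix.sub_mul, Matrix.mul_sub, Matrix.mul_sub, rowProj_mul_self hu]
    simp
  have hQA : Q * Aᵀ = 0 := by
    have : A * Q = 0 := by rw [hQ, Matrix.mul_sub, mul_rowProj hu, Matrix.mul_one, sub_self]
    have := congrArg Matrix.transpose this
    rwa [Matrix.transpose_mul, hQs, Matrix.transpose_zero] at this
  have hne : ∀ i : Fin l, σ (Fin.castLE hl i) ≠ 0 := fun i => (hc.trans_le (hσ i)).ne'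
  have hQU : Q * UL = Q * M * UL * Matrix.diagonal fun i : Fin l => (σ (Fin.castLE hl i))⁻¹ := by
    have h1 : Q * M = Q * K := by
      rw [hK, Matrix.mul_add, Matrix.mul_assoc Aᵀ, ← Matrix.mul_assoc Q Aᵀ, hQA, Matrix.zero_mul,
        add_zero]
    rw [h1, Matrix.mul_assoc Q K, h.mul_left_block, Matrix.mul_assoc, Matrix.mul_assoc,
      Matrix.diagonal_mul_diagonal]
    simp [hne]
  have hD : ‖Matrix.diagonal fun i : Fin l => (σ (Fin.castLE hl i))⁻¹‖ ≤ c⁻¹ := by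
    rw [Matrix.l2_opNorm_diagonal, pi_norm_le_iff_of_nonneg (inv_nonneg.2 hc.le)]
    intro i
    rw [Real.norm_of_nonneg (inv_nonneg.2 (hc.trans_le (hσ i)).le)]
    exact inv_anti₀ hc (hσ i)
  have h2 : UL - rowProj A * UL = Q * UL := by rw [hQ, Matrix.sub_mul, Matrix.one_mul]
  rw [h2, hQU]
  have := matrix_norm_mul_le_of_le (matrix_norm_mul_le_of_le (matrix_norm_mul_le_of_le
    (norm_le_one_of_symm_idempotent hQs hQi) hM) (norm_le_one_of_transpose_mul_self h.orthoL)) hD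
  simpa [div_eq_mul_inv] using this

theorem IsSpectralSplit.exists_orthonormal_bases (h : IsSpectralSplit hl K σ UL US)
    (hcard : Fintype.card ι = l) (hm : 0 < m)
    (hA : ∀ c, m * (c ⬝ᵥ c) ≤ (Aᵀ *ᵥ c) ⬝ᵥ (Aᵀ *ᵥ c)) {ε : ℝ} (hε : ε < 1 / 2)
    (hUL : ‖UL - rowProj A * UL‖ ≤ ε) :
    ∃ (Y : Matrix (Fin n) (Fin l) ℝ) (Z : Matrix (Fin n) (Fin (n - l)) ℝ),
      Yᵀ * Y = 1 ∧ Zᵀ * Z = 1 ∧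
      Submodule.span ℝ (Set.range Y.col) = Submodule.span ℝ (Set.range A.row) ∧
      Submodule.span ℝ (Set.range Z.col) = LinearMap.ker A.mulVecLin ∧
      ‖UL - Y‖ ≤ 4 * ε ∧ ‖US - Z‖ ≤ 4 * ε := by
  have hu := isUnit_det_mul_transpose hm hA
  have hli := linearIndependent_row_of_le hm hA
  have hε0 : 0 ≤ ε := (norm_nonneg _).trans hUL
  obtain ⟨Y, hY, hPY, hULY⟩ := exists_orthonormal_cols_in_range (transpose_rowProj A)
    (rowProj_mul_self hu) h.orthoL (by linarith) hUL
  have hYs : Submodule.span ℝ (Set.range Y.col) = Submodule.span ℝ (Set.range A.row) :=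
    span_col_eq_of_mem hY (col_mem_span_row_of_rowProj_mul_eq hPY)
      (by rw [finrank_span_eq_card hli, hcard, Fintype.card_fin])
  have hPYY : rowProj A = Y * Yᵀ := by
    refine eq_mul_transpose_of_span_col_eq (transpose_rowProj A) hY hPY fun j => ?_
    rw [hYs]
    exact col_mem_span_row_of_rowProj_mul_eq (rowProj_mul_self hu) j
  -- As `U_Lᵀ U_S = 0`, the row-space part of `U_S` is `Y Yᵀ U_S = -Y (U_L - Y)ᵀ U_S`, so the bound
  -- for `U_L` transfers. A second polar factor doubles `2 ε`, which is why `ε < 1 / 2` is required.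
  have hUS : ‖US - (1 - rowProj A) * US‖ ≤ 2 * ε := by
    have h1 : US - (1 - rowProj A) * US = Y * -((UL - Y)ᵀ * US) := by
      rw [Matrix.transpose_sub, Matrix.sub_mul ULᵀ, h.orthoLS, zero_sub, neg_neg,
        ← Matrix.mul_assoc, ← hPYY, Matrix.sub_mul, Matrix.one_mul, sub_sub_cancel]
    rw [h1]
    have h2 := matrix_norm_mul_le_of_le ((norm_transpose_eq (UL - Y)).trans_le hULY)
      (norm_le_one_of_transpose_mul_self h.orthoS)
    have := matrix_norm_mul_le_of_le (norm_le_one_of_transpose_mul_self hY)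
      ((norm_neg _).trans_le h2)
    linarith
  have hQs : (1 - rowProj A)ᵀ = 1 - rowProj A := by
    rw [Matrix.transpose_sub, transpose_rowProj, Matrix.transpose_one]
  have hQi : (1 - rowProj A) * (1 - rowProj A) = 1 - rowProj A := by
    rw [Matrix.sub_mul, Matrix.mul_sub, Matrix.mul_sub, rowProj_mul_self hu]
    simp
  obtain ⟨Z, hZ, hPZ, hUSZ⟩ := exists_orthonormal_cols_in_range hQs hQi h.orthoS
    (by linarith) hUS
  refine ⟨Y, Z, hY, hZ, hYs, ?_, by linarith, by linarith⟩
  exact span_col_eq_of_mem hZ (col_mem_ker_of_one_sub_rowProj_mul_eq hu hPZ)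
    (by rw [finrank_ker_mulVecLin hcard hli, Fintype.card_fin])

end Core

/-! ### Finsler's lemma -/

section Finsler

variable {ι n : Type*} [Fintype ι] [Fintype n]

/-- A quadratic form that is positive on the kernel of `A` becomes positive definite after a
multiple of `‖A d‖²` is added. -/
theorem exists_pos_le_dotProduct_mulVec_add (M : Matrix n n ℝ) (A : Matrix ι n ℝ)
    (h : ∀ d, A *ᵥ d = 0 → d ≠ 0 → 0 < d ⬝ᵥ M *ᵥ d) :
    ∃ τ > (0 : ℝ), ∃ η > (0 : ℝ), ∀ d,
      η * (d ⬝ᵥ d) ≤ d ⬝ᵥ M *ᵥ d + τ * ((A *ᵥ d) ⬝ᵥ (A *ᵥ d)) := by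
  set S : Set (n → ℝ) := {d | d ⬝ᵥ d = 1} with hS
  have hcont : ∀ τ : ℝ, Continuous fun d : n → ℝ =>
      d ⬝ᵥ M *ᵥ d + τ * ((A *ᵥ d) ⬝ᵥ (A *ᵥ d)) := fun τ => by fun_prop
  have hSc : IsCompact S := by
    refine Metric.isCompact_of_isClosed_isBounded
      (isClosed_eq (by fun_prop) continuous_const) ?_
    refine (Metric.isBounded_iff_subset_closedBall 0).2 ⟨1, fun d hd => ?_⟩
    rw [mem_closedBall_zero_iff, pi_norm_le_iff_of_nonneg zero_le_one]
    intro i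
    have h1 : d i * d i ≤ d ⬝ᵥ d :=
      Finset.single_le_sum (f := fun i => d i * d i) (fun i _ => mul_self_nonneg _)
        (Finset.mem_univ i)
    rw [hS, Set.mem_ofPred_eq] at hd
    rw [Real.norm_eq_abs, ← sq_le_one_iff_abs_le_one]
    nlinarith
  have hSne : ∀ d ∈ S, d ≠ 0 := by
    rintro d hd rfl
    simp [hS] at hd
  -- The sets where the form with coefficient `k + 1` is positive are open, increase with `k` and
  -- cover the unit sphere; by compactness one of them suffices.
  obtain ⟨k, hk⟩ := hSc.elim_directed_cover
    (fun k : ℕ => {d | 0 < d ⬝ᵥ M *ᵥ d + ((k : ℝ) + 1) * ((A *ᵥ d) ⬝ᵥ (A *ᵥ d))})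
    (fun k => isOpen_lt continuous_const (hcont _)) (fun d hd => by
      rw [Set.mem_iUnion]
      by_cases hAd : A *ᵥ d = 0
      · exact ⟨0, by simpa [hAd] using h d hAd (hSne d hd)⟩
      · have hp := dotProduct_self_pos hAd
        obtain ⟨k, hk⟩ := exists_nat_gt (-(d ⬝ᵥ M *ᵥ d) / ((A *ᵥ d) ⬝ᵥ (A *ᵥ d)))
        refine ⟨k, ?_⟩
        rw [div_lt_iff₀ hp] at hk
        rw [Set.mem_ofPred_eq]
        nlinarith)
    (directed_of_isDirected_le fun a b hab d hd => by
      have h1 : (a : ℝ) ≤ b := Nat.cast_le.2 hab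
      rw [Set.mem_ofPred_eq] at hd ⊢
      nlinarith [dotProduct_self_nonneg' (A *ᵥ d)])
  refine ⟨k + 1, by positivity, ?_⟩
  have hmin : ∃ η > (0 : ℝ), ∀ d ∈ S,
      η ≤ d ⬝ᵥ M *ᵥ d + ((k : ℝ) + 1) * ((A *ᵥ d) ⬝ᵥ (A *ᵥ d)) := by
    rcases S.eq_empty_or_nonempty with he | hne
    · exact ⟨1, one_pos, by simp [he]⟩
    · obtain ⟨d₀, hd₀, hmin⟩ := hSc.exists_isMinOn hne (hcont (k + 1)).continuousOn
      exact ⟨_, hk hd₀, fun d hd => hmin hd⟩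
  obtain ⟨η, hη, hle⟩ := hmin
  refine ⟨η, hη, fun d => ?_⟩
  by_cases hd : d = 0
  · simp [hd]
  have hp := dotProduct_self_pos hd
  set a := Real.sqrt (d ⬝ᵥ d) with ha
  have ha2 : a ^ 2 = d ⬝ᵥ d := Real.sq_sqrt hp.le
  have ha0 : 0 < a := Real.sqrt_pos.2 hp
  have h1 := hle (a⁻¹ • d) (by
    rw [hS, Set.mem_ofPred_eq, smul_dotProduct, dotProduct_smul, ← ha2, smul_eq_mul, smul_eq_mul]
    field_simp)
  simp only [Matrix.mulVec_smul, smul_dotProduct, dotProduct_smul, smul_eq_mul] at h1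
  rw [← ha2]
  have h2 := mul_le_mul_of_nonneg_right h1 (sq_nonneg a)
  refine h2.trans_eq ?_
  field_simp

/-- The bound of `exists_pos_le_dotProduct_mulVec_add` persists under small perturbations. -/
theorem le_dotProduct_mulVec_add_of_near [DecidableEq n] {M M' : Matrix n n ℝ}
    {A A' : Matrix ι n ℝ} {τ η δ ω : ℝ} (hτ : 0 ≤ τ) (hM : ‖M' - M‖ ≤ ω) (hA : ‖A' - A‖ ≤ δ)
    {d : n → ℝ} (h : η * (d ⬝ᵥ d) ≤ d ⬝ᵥ M *ᵥ d + τ * ((A *ᵥ d) ⬝ᵥ (A *ᵥ d))) :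
    (η - ω - 2 * τ * δ ^ 2) * (d ⬝ᵥ d)
      ≤ d ⬝ᵥ M' *ᵥ d + 2 * τ * ((A' *ᵥ d) ⬝ᵥ (A' *ᵥ d)) := by
  have h1 := neg_le_of_abs_le (abs_dotProduct_mulVec_le (M' - M) d)
  have h2 := mulVec_dotProduct_mulVec_le (A' - A) d
  have h3 := pow_le_pow_left₀ (norm_nonneg _) hA 2
  have h4 := dotProduct_self_nonneg' d
  have h5 := dotProduct_self_nonneg' ((A' *ᵥ d + (A' - A) *ᵥ d))
  rw [Matrix.sub_mulVec] at h1 h2 h5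
  rw [dotProduct_sub] at h1
  -- The two sides differ by `|2 A' d - A d|²`, which is `h5`; this is the source of the factor `2
  -- τ`.
  have h6 : (A *ᵥ d) ⬝ᵥ (A *ᵥ d) ≤ 2 * ((A' *ᵥ d) ⬝ᵥ (A' *ᵥ d))
      + 2 * ((A' *ᵥ d - A *ᵥ d) ⬝ᵥ (A' *ᵥ d - A *ᵥ d)) := by
    simp only [dotProduct_sub, sub_dotProduct, dotProduct_add, add_dotProduct] at h5 ⊢
    rw [dotProduct_comm (A *ᵥ d) (A' *ᵥ d)] at h5 ⊢
    linarith
  have h7 : (A *ᵥ d) ⬝ᵥ (A *ᵥ d) ≤ 2 * ((A' *ᵥ d) ⬝ᵥ (A' *ᵥ d)) + 2 * (δ ^ 2 * (d ⬝ᵥ d)) := by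
    nlinarith
  nlinarith [mul_le_mul_of_nonneg_left h7 hτ]

end Finsler

/-! ### Derivatives of the problem data -/

section Derivatives

variable {n m : ℕ}

theorem gradient_apply_eq_fderiv (F : EuclideanSpace ℝ (Fin n) → ℝ) (x : EuclideanSpace ℝ (Fin n))
    (i : Fin n) : gradient F x i = fderiv ℝ F x (EuclideanSpace.single i 1) := by
  have h : inner ℝ (gradient F x) (EuclideanSpace.single i 1)
      = fderiv ℝ F x (EuclideanSpace.single i 1) := by
    simp [gradient]
  rw [← h, EuclideanSpace.inner_single_right]
  simp

/-- Reduces the symmetry of the Hessian matrix to that of the second Fréchet derivative. -/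
theorem jacobianMatrix_gradient_apply {F : EuclideanSpace ℝ (Fin n) → ℝ} (hF : ContDiff ℝ 2 F)
    (x : EuclideanSpace ℝ (Fin n)) (i j : Fin n) :
    jacobianMatrix (gradient F) x i j = fderiv ℝ (fderiv ℝ F) x (EuclideanSpace.single j 1)
      (EuclideanSpace.single i 1) := by
  have hd : DifferentiableAt ℝ (fderiv ℝ F) x :=
    ((hF.fderiv_right (m := 1) (by norm_num)).differentiable one_ne_zero) x
  have hc : ∀ i, HasFDerivAt (fun x => gradient F x i)
      ((ContinuousLinearMap.apply ℝ ℝ (EuclideanSpace.single i 1)).comp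
        (fderiv ℝ (fderiv ℝ F) x)) x := fun i => by
    simp only [gradient_apply_eq_fderiv]
    exact (ContinuousLinearMap.apply ℝ ℝ (EuclideanSpace.single i 1)).hasFDerivAt.comp x
      hd.hasFDerivAt
  have hg : DifferentiableAt ℝ (gradient F) x :=
    differentiableAt_euclidean.2 fun i => (hc i).differentiableAt
  have h1 := ((EuclideanSpace.proj (𝕜 := ℝ) i).hasFDerivAt.comp x hg.hasFDerivAt).unique (hc i)
  exact congrArg (fun T => T (EuclideanSpace.single j 1)) h1

theorem transpose_jacobianMatrix_gradient {F : EuclideanSpace ℝ (Fin n) → ℝ}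
    (hF : ContDiff ℝ 2 F) (x : EuclideanSpace ℝ (Fin n)) :
    (jacobianMatrix (gradient F) x)ᵀ = jacobianMatrix (gradient F) x := by
  ext i j
  rw [Matrix.transpose_apply, jacobianMatrix_gradient_apply hF, jacobianMatrix_gradient_apply hF]
  exact (hF.contDiffAt.isSymmSndFDerivAt (by simp)) _ _

theorem continuous_jacobianMatrix {F : EuclideanSpace ℝ (Fin n) → EuclideanSpace ℝ (Fin m)}
    (hF : ContDiff ℝ 2 F) : Continuous (jacobianMatrix F) := by
  refine continuous_matrix fun i j => ?_
  have h1 : Continuous fun x => fderiv ℝ F x (EuclideanSpace.single j 1) :=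
    (hF.continuous_fderiv two_ne_zero).clm_apply continuous_const
  exact (EuclideanSpace.proj i).continuous.comp h1

end Derivatives

namespace PDPoint

variable {n me mi : ℕ} (w w' : PDPoint n me mi)

theorem norm_x_sub_le_edist : ‖w.x - w'.x‖ ≤ w.edist w' :=
  Real.le_sqrt_of_sq_le <| by
    nlinarith [sq_nonneg ‖w.s - w'.s‖, sq_nonneg ‖w.y - w'.y‖,
      sq_nonneg ‖w.z - w'.z‖, sq_nonneg ‖w.v - w'.v‖]

theorem abs_s_sub_le_edist (i : Fin mi) : |w.s i - w'.s i| ≤ w.edist w' :=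
  (PiLp.norm_apply_le (w.s - w'.s) i).trans <|
    Real.le_sqrt_of_sq_le <| by
    nlinarith [sq_nonneg ‖w.x - w'.x‖, sq_nonneg ‖w.y - w'.y‖,
      sq_nonneg ‖w.z - w'.z‖, sq_nonneg ‖w.v - w'.v‖]

theorem abs_v_sub_le_edist (i : Fin mi) : |w.v i - w'.v i| ≤ w.edist w' :=
  (PiLp.norm_apply_le (w.v - w'.v) i).trans <|
    Real.le_sqrt_of_sq_le <| by
    nlinarith [sq_nonneg ‖w.x - w'.x‖, sq_nonneg ‖w.y - w'.y‖,
      sq_nonneg ‖w.z - w'.z‖, sq_nonneg ‖w.s - w'.s‖]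

theorem edist_self_eq_zero : w.edist w = 0 := by
  simp [edist]

theorem edist_nonneg : 0 ≤ w.edist w' := Real.sqrt_nonneg _

end PDPoint

/-! ### The condensed matrix: symmetry and the splitting by active set. -/

namespace NLP

variable {n me mi : ℕ} (P : NLP n me mi)

theorem contDiff_lagrangian_x (w : PDPoint n me mi) :
    ContDiff ℝ 2 fun x => P.lagrangian { w with x := x } := by
  have hf := P.contDiff_f
  have hg := P.contDiff_g
  have hh := P.contDiff_h
  unfold lagrangian
  exact ((hf.add (contDiff_const.inner ℝ hg)).add
    (contDiff_const.inner ℝ (hh.add contDiff_const))).sub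
      (contDiff_const (c := inner ℝ w.v w.s))

theorem transpose_hessian (w : PDPoint n me mi) : (P.hessian w)ᵀ = P.hessian w :=
  transpose_jacobianMatrix_gradient (P.contDiff_lagrangian_x w) w.x

/-- At a KKT point this gives `z = v`, which moves strict complementarity from `z` to `v`. -/
theorem gradS_eq_sub (w : PDPoint n me mi) : P.gradS w = w.z - w.v := by
  have h1 : HasFDerivAt (fun s => P.lagrangian { w with s := s })
      (innerSL ℝ w.z - innerSL ℝ w.v) w.s := by
    have hz : HasFDerivAt (fun s => inner ℝ w.z (P.h w.x + s)) (innerSL ℝ w.z) w.s :=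
      (innerSL ℝ w.z).hasFDerivAt.comp w.s ((hasFDerivAt_id w.s).const_add (P.h w.x))
    exact (hz.const_add (P.f w.x + inner ℝ w.y (P.g w.x))).sub (innerSL ℝ w.v).hasFDerivAt
  refine ext_inner_right ℝ fun u => ?_
  rw [gradS, gradient, h1.fderiv, InnerProductSpace.toDual_symm_apply, inner_sub_left]
  rfl

theorem continuous_activeJacobian (B : Finset (Fin mi)) : Continuous (P.activeJacobian B) := by
  have hg := continuous_jacobianMatrix P.contDiff_g
  have hh := continuous_jacobianMatrix P.contDiff_h
  refine continuous_matrix fun i j => ?_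
  rcases i with i | i
  · exact hh.matrix_elem i.1 j
  · exact hg.matrix_elem i j

/-- The part of the condensed matrix that stays bounded near a solution with active set `B`. -/
noncomputable def boundedPart (B : Finset (Fin mi)) (w : PDPoint n me mi) :
    Matrix (Fin n) (Fin n) ℝ :=
  P.hessian w + (jacobianMatrix P.h w.x)ᵀ
    * Matrix.diagonal (fun i => if i ∈ B then 0 else w.v i / w.s i) * jacobianMatrix P.h w.x

theorem transpose_mul_diagonal_mul_apply {ι k : Type*} [Fintype ι] [DecidableEq ι]
    (A : Matrix ι k ℝ) (d : ι → ℝ) (a b : k) :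
    (Aᵀ * Matrix.diagonal d * A) a b = ∑ i, A i a * d i * A i b := by
  rw [Matrix.mul_apply]
  simp only [Matrix.mul_diagonal, Matrix.transpose_apply]

theorem condensed_eq (B : Finset (Fin mi)) (γ : ℝ) (w : PDPoint n me mi) :
    P.condensed γ w = P.boundedPart B w + (P.activeJacobian B w.x)ᵀ
      * Matrix.diagonal (Sum.elim (fun i : B => w.v i / w.s i) fun _ : Fin me => γ)
      * P.activeJacobian B w.x := by
  rw [condensed, boundedPart, add_assoc, add_assoc]
  congr 1
  ext j k
  simp only [Matrix.add_apply, transpose_mul_diagonal_mul_apply]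
  simp only [Matrix.mul_apply, Matrix.transpose_apply, Matrix.smul_apply, smul_eq_mul, Fintype.sum_sum_type, activeJacobian, Matrix.fromRows_apply_inl,
    Matrix.fromRows_apply_inr, Matrix.submatrix_apply, id, Sum.elim_inl, Sum.elim_inr]
  rw [← add_assoc, Finset.sum_coe_sort B (fun i => jacobianMatrix P.h w.x i j
    * (w.v i / w.s i) * jacobianMatrix P.h w.x i k)]
  congr 1
  · rw [← Fintype.sum_ite_mem B, ← Finset.sum_add_distrib]
    refine Finset.sum_congr rfl fun i _ => ?_
    by_cases hi : i ∈ B <;> simp [hi]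
  · rw [Finset.mul_sum]
    exact Finset.sum_congr rfl fun i _ => by ring

theorem transpose_condensed (γ : ℝ) (w : PDPoint n me mi) :
    (P.condensed γ w)ᵀ = P.condensed γ w := by
  simp only [condensed, Matrix.transpose_add, Matrix.transpose_mul, Matrix.transpose_smul,
    Matrix.transpose_transpose, Matrix.diagonal_transpose, transpose_hessian, Matrix.mul_assoc]

/-! ### Bounds that hold uniformly near a regular solution. -/

variable {P}

theorem IsRegularSolution.s_add_v_pos {w : PDPoint n me mi} (h : P.IsRegularSolution w)
    (i : Fin mi) : 0 < w.s i + w.v i := by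
  have hzv : w.z = w.v := by
    have := h.kkt.gradS_eq
    rwa [gradS_eq_sub, sub_eq_zero] at this
  by_cases hi : i ∈ P.activeSet w.x
  · have := h.scs i hi
    rw [hzv] at this
    linarith [h.kkt.s_nonneg i]
  · have h1 : P.h w.x i ≠ 0 := by simpa [activeSet] using hi
    have h2 : P.h w.x i + w.s i = 0 := congrArg (fun u : EuclideanSpace ℝ (Fin mi) => u i)
      h.kkt.ineq_feasible
    have h3 : w.s i ≠ 0 := fun h0 => h1 (by rw [h0, add_zero] at h2; exact h2)
    have := lt_of_le_of_ne (h.kkt.s_nonneg i) h3.symm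
    linarith [h.kkt.v_nonneg i]

theorem IsKKT.s_eq_zero_iff {w : PDPoint n me mi} (h : P.IsKKT w) (i : Fin mi) :
    w.s i = 0 ↔ i ∈ P.activeSet w.x := by
  have h2 : P.h w.x i + w.s i = 0 := congrArg (fun u : EuclideanSpace ℝ (Fin mi) => u i)
    h.ineq_feasible
  simp only [activeSet, Finset.mem_filter_univ]
  constructor <;> intro h0 <;> linarith

/-- Strict complementarity with a uniform margin. -/
theorem IsRegularSolution.exists_margin {w : PDPoint n me mi} (h : P.IsRegularSolution w) :
    ∃ ν > (0 : ℝ), (∀ i ∈ P.activeSet w.x, ν ≤ w.v i) ∧ ∀ i ∉ P.activeSet w.x, ν ≤ w.s i := by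
  have h1 : ∃ ν > (0 : ℝ), ∀ i, ν ≤ w.s i + w.v i := by
    have hev : ∀ᶠ ν in nhdsWithin (0 : ℝ) (Set.Ioi 0), ∀ i, ν ≤ w.s i + w.v i :=
      Filter.eventually_all.2 fun i => by
        filter_upwards [Ioo_mem_nhdsGT (h.s_add_v_pos i)] with ν hν using hν.2.le
    obtain ⟨ν, h1, h2⟩ := (hev.and self_mem_nhdsWithin).exists
    exact ⟨ν, h2, h1⟩
  obtain ⟨ν, hν, hle⟩ := h1
  refine ⟨ν, hν, fun i hi => ?_, fun i hi => ?_⟩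
  · have := hle i
    rwa [(h.kkt.s_eq_zero_iff i).2 hi, zero_add] at this
  · have h0 : w.s i ≠ 0 := fun h0 => hi ((h.kkt.s_eq_zero_iff i).1 h0)
    have := hle i
    rwa [(mul_eq_zero.1 (h.kkt.complementary i)).resolve_left h0, add_zero] at this

theorem norm_boundedPart_le {B : Finset (Fin mi)} {w : PDPoint n me mi} {a b c : ℝ}
    (ha : ‖P.hessian w‖ ≤ a) (hb : ‖jacobianMatrix P.h w.x‖ ≤ b) (hc : 0 ≤ c)
    (hvs : ∀ i ∉ B, |w.v i / w.s i| ≤ c) : ‖P.boundedPart B w‖ ≤ a + b * c * b := by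
  refine (norm_add_le _ _).trans (add_le_add ha ?_)
  refine matrix_norm_mul_le_of_le (matrix_norm_mul_le_of_le
    ((norm_transpose_eq _).trans_le hb) ?_) hb
  rw [Matrix.l2_opNorm_diagonal, pi_norm_le_iff_of_nonneg hc]
  intro i
  by_cases hi : i ∈ B
  · simpa [hi] using hc
  · simpa only [hi, if_false, Real.norm_eq_abs] using hvs i hi

/-- Each estimate holds at the solution with room to spare and survives on a small ball by
continuity. The radius and constants precede `C` and `α`, as the order of quantifiers in the theorem
demands. -/
theorem IsRegularSolution.exists_uniform_bounds {wstar : PDPoint n me mi}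
    (hstar : P.IsRegularSolution wstar) :
    ∃ r > (0 : ℝ), ∃ κ > (0 : ℝ), ∃ m > (0 : ℝ), ∃ τ > (0 : ℝ), ∃ ν > (0 : ℝ),
      ∀ w : PDPoint n me mi, w.edist wstar ≤ r →
        (∀ c, m * (c ⬝ᵥ c) ≤ ((P.activeJacobian (P.activeSet wstar.x) w.x)ᵀ *ᵥ c)
          ⬝ᵥ ((P.activeJacobian (P.activeSet wstar.x) w.x)ᵀ *ᵥ c)) ∧
        (∀ d, d ≠ 0 → 0 < d ⬝ᵥ P.hessian w *ᵥ d
          + τ * ((P.activeJacobian (P.activeSet wstar.x) w.x *ᵥ d)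
            ⬝ᵥ (P.activeJacobian (P.activeSet wstar.x) w.x *ᵥ d))) ∧
        (∀ i ∈ P.activeSet wstar.x, ν ≤ w.v i) ∧
        ‖P.boundedPart (P.activeSet wstar.x) w‖ ≤ κ := by
  set B := P.activeSet wstar.x with hB
  set A := P.activeJacobian B wstar.x with hA
  obtain ⟨ν, hν, hνv, hνs⟩ := hstar.exists_margin
  obtain ⟨ρ, hρ, L, hL⟩ := hstar.lipschitz
  obtain ⟨τ, hτ, η, hη, hq⟩ := exists_pos_le_dotProduct_mulVec_add _ _ hstar.sosc
  -- Finsler's lemma with an empty constraint matrix is plain compactness: it turns positivity of `A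
  -- Aᵀ` into a uniform bound `m`.
  obtain ⟨_, _, m, hm, hrow⟩ := exists_pos_le_dotProduct_mulVec_add (Aᵀᵀ * Aᵀ)
    (0 : Matrix (Fin 0) _ ℝ) (fun c _ hc => by
      rw [dotProduct_transpose_mul_mulVec]
      refine dotProduct_self_pos fun h0 => hc ?_
      have hinj : Function.Injective Aᵀ.mulVec := Matrix.mulVec_injective_iff.2 hstar.licq
      exact hinj (h0.trans (Matrix.mulVec_zero _).symm))
  have hrow' : ∀ c, m * (c ⬝ᵥ c) ≤ c ⬝ᵥ (0 : Matrix _ _ ℝ) *ᵥ c + 1 * ((Aᵀ *ᵥ c) ⬝ᵥ (Aᵀ *ᵥ c)) :=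
    fun c => by
      have := hrow c
      rw [dotProduct_transpose_mul_mulVec] at this
      simpa using this
  -- After perturbation these bounds leave `m - 2 δ² ≥ m / 2` and, with `ω = η / 4`, `η - ω - 2 τ δ²
  -- ≥ η / 2`. Halving the former, because of the doubled coefficient, gives `m / 4`.
  set δ := min (Real.sqrt (m / 4)) (Real.sqrt (η / (8 * τ))) with hδ
  have hδ0 : 0 < δ := lt_min (Real.sqrt_pos.2 (by positivity)) (Real.sqrt_pos.2 (by positivity))
  have hδm : δ ^ 2 ≤ m / 4 :=
    (pow_le_pow_left₀ hδ0.le (min_le_left _ _) 2).trans_eq (Real.sq_sqrt (by positivity))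
  have hδη : δ ^ 2 ≤ η / (8 * τ) :=
    (pow_le_pow_left₀ hδ0.le (min_le_right _ _) 2).trans_eq (Real.sq_sqrt (by positivity))
  obtain ⟨r₁, hr₁, hAr⟩ := Metric.continuousAt_iff.1
    (P.continuous_activeJacobian B).continuousAt δ hδ0
  obtain ⟨r₂, hr₂, hHr⟩ := Metric.continuousAt_iff.1
    (continuous_jacobianMatrix P.contDiff_h).continuousAt 1 one_pos
  set ω := η / 4 with hω
  have hr : ∃ r > (0 : ℝ), r < r₁ ∧ r < r₂ ∧ r ≤ ρ ∧ r ≤ ν / 2 ∧ r ≤ 1 ∧ L * r ≤ ω := by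
    refine ⟨min (min (r₁ / 2) (r₂ / 2)) (min (min ρ (ν / 2)) (min 1 (ω / (|L| + 1)))),
      by positivity, ?_, ?_, ?_, ?_, ?_, ?_⟩
    · exact ((min_le_left _ _).trans (min_le_left _ _)).trans_lt (half_lt_self hr₁)
    · exact ((min_le_left _ _).trans (min_le_right _ _)).trans_lt (half_lt_self hr₂)
    · exact ((min_le_right _ _).trans (min_le_left _ _)).trans (min_le_left _ _)
    · exact ((min_le_right _ _).trans (min_le_left _ _)).trans (min_le_right _ _)
    · exact ((min_le_right _ _).trans (min_le_right _ _)).trans (min_le_left _ _)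
    · set r := min (min (r₁ / 2) (r₂ / 2)) (min (min ρ (ν / 2)) (min 1 (ω / (|L| + 1))))
      have h1 : r ≤ ω / (|L| + 1) :=
        ((min_le_right _ _).trans (min_le_right _ _)).trans (min_le_right _ _)
      have h0 : 0 < r := by positivity
      rw [le_div_iff₀ (by positivity)] at h1
      nlinarith [le_abs_self L]
  obtain ⟨r, hr0, hrr₁, hrr₂, hrρ, hrν, hr1, hrL⟩ := hr
  set a := ‖P.hessian wstar‖ + ω with ha
  set b := ‖jacobianMatrix P.h wstar.x‖ + 1 with hb
  -- Bounds `vᵢ / sᵢ` for inactive `i`: the numerator uses `r ≤ 1`, the denominator `r ≤ ν / 2`.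
  set c := (‖wstar.v‖ + 1) / (ν / 2) with hc
  have hω0 : 0 < ω := by positivity
  refine ⟨r, hr0, a + b * c * b, by positivity, m / 4, by positivity, 2 * τ, by positivity, ν / 2,
    by positivity, fun w hw => ?_⟩
  have hx := (w.norm_x_sub_le_edist wstar).trans hw
  have hAw : ‖P.activeJacobian B w.x - A‖ ≤ δ := by
    rw [← dist_eq_norm]
    exact (hAr (by rw [dist_eq_norm]; exact hx.trans_lt hrr₁)).le
  have hHw : ‖jacobianMatrix P.h w.x - jacobianMatrix P.h wstar.x‖ ≤ 1 := by
    rw [← dist_eq_norm]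
    exact (hHr (by rw [dist_eq_norm]; exact hx.trans_lt hrr₂)).le
  have hW : ‖P.hessian w - P.hessian wstar‖ ≤ ω := by
    refine (hL w wstar (hw.trans hrρ) (by rw [PDPoint.edist_self_eq_zero]; exact hρ.le)).trans ?_
    have := w.edist_nonneg wstar
    rcases le_total 0 L with h0 | h0 <;> nlinarith
  refine ⟨fun c => ?_, fun d hd => ?_, fun i hi => ?_, ?_⟩
  · have h1 := le_dotProduct_mulVec_add_of_near (M' := 0) (A' := (P.activeJacobian B w.x)ᵀ)
      (ω := 0) (δ := δ) zero_le_one (by simp) (by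
        rw [← Matrix.transpose_sub, norm_transpose_eq]; exact hAw) (hrow' c)
    rw [Matrix.zero_mulVec, dotProduct_zero] at h1
    nlinarith [dotProduct_self_nonneg' c]
  · have h1 := le_dotProduct_mulVec_add_of_near hτ.le hW hAw (hq d)
    refine lt_of_lt_of_le (mul_pos ?_ (dotProduct_self_pos hd)) h1
    rw [le_div_iff₀ (by positivity)] at hδη
    nlinarith
  · have h1 := neg_le_of_abs_le ((w.abs_v_sub_le_edist wstar i).trans hw)
    linarith [hνv i hi]
  · refine norm_boundedPart_le ?_ ?_ (by positivity) fun i hi => ?_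
    · have := norm_add_le (P.hessian wstar) (P.hessian w - P.hessian wstar)
      rw [add_sub_cancel] at this
      linarith
    · have := norm_add_le (jacobianMatrix P.h wstar.x)
        (jacobianMatrix P.h w.x - jacobianMatrix P.h wstar.x)
      rw [add_sub_cancel] at this
      linarith
    · have h1 := neg_le_of_abs_le ((w.abs_s_sub_le_edist wstar i).trans hw)
      have h2 : ν / 2 ≤ w.s i := by linarith [hνs i hi]
      have h3 : |w.v i| ≤ ‖wstar.v‖ + 1 := by
        have h4 := (w.abs_v_sub_le_edist wstar i).trans hw
        have h5 : |wstar.v i| ≤ ‖wstar.v‖ := PiLp.norm_apply_le wstar.v i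
        have h6 := abs_add_le (wstar.v i) (w.v i - wstar.v i)
        rw [add_sub_cancel] at h6
        linarith
      rw [abs_div, abs_of_pos (show 0 < w.s i by linarith)]
      exact div_le_div₀ (by positivity) h3 (by positivity) h2

/-! ### Weights of the active constraints at central points. -/

theorem IsCentral.dualityMeasure_pos {C α : ℝ} {w : PDPoint n me mi} (h : P.IsCentral C α w)
    (hmi : 0 < mi) : 0 < w.dualityMeasure := by
  have : Nonempty (Fin mi) := ⟨⟨0, hmi⟩⟩
  exact div_pos (Finset.sum_pos (fun i _ => mul_pos (h.s_pos i) (h.v_pos i))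
    Finset.univ_nonempty) (Nat.cast_pos.2 hmi)

/-- `vᵢ / sᵢ = vᵢ² / (sᵢ vᵢ)`, and the product `sᵢ vᵢ` is one term of a positive sum equal to `mᵢ
Ξ`. -/
theorem IsCentral.mul_sigmaLow_le_div {C α ν : ℝ} {w : PDPoint n me mi}
    (h : P.IsCentral C α w) (hmi : 0 < mi) (hν : 0 < ν) {i : Fin mi} (hi : ν ≤ w.v i) (γ : ℝ) :
    ν ^ 2 / mi * w.sigmaLow γ ≤ w.v i / w.s i := by
  have hΞ := h.dualityMeasure_pos hmi
  have hmi' : (0 : ℝ) < mi := Nat.cast_pos.2 hmi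
  have hs := h.s_pos i
  have h1 : w.s i * w.v i ≤ mi * w.dualityMeasure := by
    rw [PDPoint.dualityMeasure, mul_div_cancel₀ _ hmi'.ne']
    exact Finset.single_le_sum (f := fun i => w.s i * w.v i)
      (fun i _ => (mul_pos (h.s_pos i) (h.v_pos i)).le) (Finset.mem_univ i)
  calc ν ^ 2 / mi * w.sigmaLow γ ≤ ν ^ 2 / mi * (1 / w.dualityMeasure) :=
        mul_le_mul_of_nonneg_left (min_le_left _ _) (by positivity)
    _ = ν ^ 2 / (mi * w.dualityMeasure) := by field_simp
    _ ≤ w.v i ^ 2 / (w.s i * w.v i) := div_le_div₀ (by positivity)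
        (pow_le_pow_left₀ hν.le hi 2) (mul_pos hs (h.v_pos i)) h1
    _ = w.v i / w.s i := by
        have := h.v_pos i
        field_simp

theorem le_condensed (B : Finset (Fin mi)) {γ t : ℝ} {w : PDPoint n me mi}
    (hs : ∀ i, 0 < w.s i) (hv : ∀ i, 0 < w.v i)
    (ht : ∀ i, t ≤ Sum.elim (fun i : B => w.v i / w.s i) (fun _ : Fin me => γ) i) (d : Fin n → ℝ) :
    d ⬝ᵥ P.hessian w *ᵥ d
        + t * ((P.activeJacobian B w.x *ᵥ d) ⬝ᵥ (P.activeJacobian B w.x *ᵥ d))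
      ≤ d ⬝ᵥ P.condensed γ w *ᵥ d := by
  rw [P.condensed_eq B, boundedPart, Matrix.add_mulVec, Matrix.add_mulVec, dotProduct_add,
    dotProduct_add]
  have h1 := le_dotProduct_transpose_mul_diagonal_mul_mulVec (P.activeJacobian B w.x) ht d
  have h2 := le_dotProduct_transpose_mul_diagonal_mul_mulVec (t := 0) (jacobianMatrix P.h w.x)
    (d := fun i => if i ∈ B then 0 else w.v i / w.s i) (fun i => by
      split_ifs
      · exact le_rfl
      · exact (div_pos (hv i) (hs i)).le) d
  rw [zero_mul] at h2
  linarith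

end NLP

theorem div_le_mul_div_of_le {a p q β : ℝ} (ha : 0 ≤ a) (hp : 0 < p) (hq : 0 < q)
    (h : q ≤ β * p) : a / p ≤ β * (a / q) := by
  rw [← mul_div_assoc, div_le_div_iff₀ hp hq]
  nlinarith [mul_le_mul_of_nonneg_left h ha]

theorem mainTheorem2 {n me mi : ℕ} (hmi : 0 < mi) (P : NLP n me mi)
    (wstar : PDPoint n me mi) (hstar : P.IsRegularSolution wstar) :
    ∃ hl : P.numActive wstar.x ≤ n, ∃ r > (0 : ℝ),
      ∀ C > (0 : ℝ), ∀ α : ℝ, 0 < α → α < 1 →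
      ∃ ξ₀ > (0 : ℝ), ∃ γ₀ > (0 : ℝ), ∃ b > (0 : ℝ),
      ∀ w : PDPoint n me mi, w.edist wstar ≤ r → P.IsCentral C α w → w.dualityMeasure ≤ ξ₀ →
      ∀ γ : ℝ, γ₀ ≤ γ →
        (∃ σ UL US, IsSpectralSplit hl (P.condensed γ w) σ UL US) ∧
        ∀ σ UL US, IsSpectralSplit hl (P.condensed γ w) σ UL US →
          (∀ i, 0 < σ i) ∧
          (∀ (h0 : 0 < P.numActive wstar.x) (hn : P.numActive wstar.x < n),
            σ ⟨0, by omega⟩ / σ ⟨P.numActive wstar.x - 1, by omega⟩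
                ≤ b * (w.sigmaLow γ)⁻¹ * (σ ⟨0, by omega⟩ / σ ⟨n - 1, by omega⟩) ∧
            σ ⟨P.numActive wstar.x, hn⟩ / σ ⟨n - 1, by omega⟩
                ≤ b * (w.sigmaLow γ)⁻¹ * (σ ⟨0, by omega⟩ / σ ⟨n - 1, by omega⟩)) ∧
          ∃ (Y : Matrix (Fin n) (Fin (P.numActive wstar.x)) ℝ)
            (Z : Matrix (Fin n) (Fin (n - P.numActive wstar.x)) ℝ),
            Yᵀ * Y = 1 ∧ Zᵀ * Z = 1 ∧
            Submodule.span ℝ (Set.range Y.col)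
              = Submodule.span ℝ
                  (Set.range (P.activeJacobian (P.activeSet wstar.x) w.x).row) ∧
            Submodule.span ℝ (Set.range Z.col)
              = LinearMap.ker (P.activeJacobian (P.activeSet wstar.x) w.x).mulVecLin ∧
            ‖UL - Y‖ ≤ b * (w.sigmaLow γ)⁻¹ ∧
            ‖US - Z‖ ≤ b * (w.sigmaLow γ)⁻¹ := by
  have hcard : Fintype.card (P.activeSet wstar.x ⊕ Fin me) = P.numActive wstar.x := by
    rw [Fintype.card_sum, Fintype.card_coe, Fintype.card_fin, NLP.numActive, add_comm]
  have hl : P.numActive wstar.x ≤ n := by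
    have := hstar.licq.fintype_card_le_finrank
    rwa [hcard, Module.finrank_fin_fun] at this
  obtain ⟨r, hr, κ, hκ, m, hm, τ, hτ, ν, hν, hbounds⟩ := hstar.exists_uniform_bounds
  have hmi' : (0 : ℝ) < mi := Nat.cast_pos.2 hmi
  refine ⟨hl, r, hr, fun C _ α _ _ => ?_⟩
  -- The first entry serves the weights `vᵢ / sᵢ`, the second serves `γ`, so that `t = c * sigmaLow`
  -- lies below both.
  set c := min (ν ^ 2 / mi) 1 with hc
  have hc0 : 0 < c := lt_min (by positivity) one_pos
  -- The threshold for `sigmaLow`. It yields `t ≥ τ`, for positive definiteness, and `t m ≥ 8 κ`,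
  -- whence `t m - κ ≥ t m / 2` and `ε = κ / (t m / 2) ≤ 1 / 4`. The value of `b` is chosen so that
  -- `b / sigmaLow = 4 ε`.
  set Θ := max τ (8 * κ / m) / c with hΘ
  have hΘ0 : 0 < Θ := by positivity
  refine ⟨Θ⁻¹, inv_pos.2 hΘ0, Θ, hΘ0, 8 * κ / (c * m), by positivity,
    fun w hw hcen hΞ γ hγ => ?_⟩
  obtain ⟨hA, hpd, hv, hM⟩ := hbounds w hw
  have hΞ0 := hcen.dualityMeasure_pos hmi
  have hsl : Θ ≤ w.sigmaLow γ := by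
    refine le_min ?_ hγ
    rw [one_div]
    exact (le_inv_comm₀ hΘ0 hΞ0).2 hΞ
  have hsl0 : 0 < w.sigmaLow γ := hΘ0.trans_le hsl
  set t := c * w.sigmaLow γ with ht
  have hct : max τ (8 * κ / m) ≤ t := by
    rw [hΘ, div_le_iff₀ hc0] at hsl
    rwa [ht, mul_comm c]
  have hτt : τ ≤ t := (le_max_left _ _).trans hct
  have htm : 8 * κ ≤ t * m := (div_le_iff₀ hm).1 ((le_max_right _ _).trans hct)
  have htm0 : 0 < t * m := by positivity
  have hD : ∀ i, t ≤ Sum.elim (fun i : P.activeSet wstar.x => w.v i / w.s i)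
      (fun _ : Fin me => γ) i := by
    rintro (i | i)
    · exact (mul_le_mul_of_nonneg_right (min_le_left _ _) hsl0.le).trans
        (hcen.mul_sigmaLow_le_div hmi hν (hv i i.2) γ)
    · exact (mul_le_of_le_one_left hsl0.le (min_le_right _ _)).trans (min_le_right _ _)
  have hK := P.condensed_eq (P.activeSet wstar.x) γ w
  have hβ : 8 * κ / (c * m) * (w.sigmaLow γ)⁻¹ = 8 * κ / (t * m) := by
    rw [ht]
    field_simp
  rw [hβ]
  have hβm : 8 * κ / (t * m) * (t * m) = 8 * κ := div_mul_cancel₀ _ htm0.ne'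
  have hβ0 : 0 < 8 * κ / (t * m) := by positivity
  refine ⟨exists_isSpectralSplit hl (P.transpose_condensed γ w), fun σ UL US hsplit => ?_⟩
  have hlarge : ∀ j : Fin n, (j : ℕ) < P.numActive wstar.x → t * m / 2 ≤ σ j := fun j hj => by
    have := hsplit.le_large hcard hK hM (hτ.le.trans hτt) hD hm hA hj
    linarith
  have hsmall : ∀ j : Fin n, P.numActive wstar.x ≤ (j : ℕ) → σ j ≤ κ := fun j hj =>
    hsplit.small_le hcard hK hM hm hA hj
  have hpos : ∀ i, 0 < σ i := by
    obtain ⟨U, hU, hKU⟩ := hsplit.exists_orthogonal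
    refine eigenvalue_pos hU hKU fun d hd => (hpd d hd).trans_le ?_
    refine le_trans ?_ (NLP.le_condensed _ hcen.s_pos hcen.v_pos hD d)
    nlinarith [dotProduct_self_nonneg' (P.activeJacobian (P.activeSet wstar.x) w.x *ᵥ d)]
  refine ⟨hpos, fun h0 hn => ⟨?_, ?_⟩, ?_⟩
  -- Both quotient bounds compare a small eigenvalue with a large one: `σ_n ≤ β σ_ℓ` here and
  -- `σ_{ℓ+1} ≤ β σ_1` next, as `β (t m / 2) = 4 κ`.
  · refine div_le_mul_div_of_le (hpos _).le (hpos _) (hpos _) ?_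
    have h1 := hsmall ⟨n - 1, by omega⟩ (Nat.le_sub_one_of_lt hn)
    have h2 := hlarge ⟨P.numActive wstar.x - 1, by omega⟩ (Nat.sub_one_lt_of_lt h0)
    nlinarith
  · rw [← mul_div_assoc]
    refine div_le_div_of_nonneg_right ?_ (hpos _).le
    have h1 := hsmall ⟨P.numActive wstar.x, hn⟩ le_rfl
    have h2 := hlarge ⟨0, by omega⟩ h0
    nlinarith
  · have hUL := hsplit.norm_left_sub_rowProj_le hK hM (isUnit_det_mul_transpose hm hA)
      (half_pos htm0) fun i => hlarge _ i.2
    have hε : κ / (t * m / 2) < 1 / 2 := by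
      rw [div_lt_iff₀ (half_pos htm0)]
      linarith
    have h4 : 4 * (κ / (t * m / 2)) = 8 * κ / (t * m) := by
      field_simp
      norm_num
    have := hsplit.exists_orthonormal_bases hcard hm hA hε hUL
    rwa [h4] at this
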